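/- For $\Delta\in(0,1]$ let $L_\Delta=2\mathbb Z\cup\bigl(2\mathbb Z+\tfrac{2\Delta}{1+\Delta}\bigr)$ and, for $s>1$, let $E(s,\Delta)=\frac14\sum_{k\in\{0,2\Delta/(1+\Delta)\}}\sum_{p\in L_\Delta,\,p\neq k}|p-k|^{-s}$ be its Riesz energy per point. It equals $$E(s,\Delta)=\frac{1}{2^s}\zeta(s)+\frac1{2^{s+1}}\Bigl[\zeta\bigl(s,\tfrac1{1+\Delta}\bigr)+\zeta\bigl(s,\tfrac{\Delta}{1+\Delta}\bigr)\Bigr]$$ ($\zeta(s,a)$ the Hurwitz zeta function), and this formula continues it analytically to $s\in\mathbb C\setminus\{1\}$. Zeros of $E(\cdot,\Delta)$ are taken in $\mathbb C\setminus\{1\}$. **Theorem.** As $\varepsilon\to0^+$, the zeros of $E(\cdot,1-\varepsilon)$ are, besides those that tend to zeros of $\zeta$ (that is, under the Riemann Hypothesis, to the trivial and the critical zeros), a family of nontrivial off-critical zeros $\rho(k)=\rho_x(k)+i\rho_y(k)$, $k\in\mathbb Z$. Precisely, there are $\rho(k)=\rho_\varepsilon(k)\in\mathbb C$ such that: (a)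 for all sufficiently small $\varepsilon>0$, the $\rho(k)$, $k\in\mathbb Z$, are pairwise distinct zeros of $E(\cdot,1-\varepsilon)$ with $\rho_x(k)<0$, and none of them is a zero of $\zeta$; (b) for every $\sigma<0$ and all sufficiently small $\varepsilon>0$ (depending on $\sigma$), the zeros of $E(\cdot,1-\varepsilon)$ with $\Re s\le\sigma$ are exactly those of the numbers $-2,-4,-6,\dots$ and $\rho(k)$, $k\in\mathbb Z$, that have real part at most $\sigma$; (c) for all $T,\eta>0$ and all sufficiently small $\varepsilon>0$ (depending on $T,\eta$), every zero $s$ of $E(\cdot,1-\varepsilon)$ with $|\Im s|\le T$ either is one of the $\rho(k)$ or lies at distance less than $\eta$ from a zero of $\zeta$; conversely, every zero of $\zeta$ is a limit, as $\varepsilon\to0^+$, of zeros of $E(\cdot,1-\varepsilon)$; (d) as $\varepsilon\to0^+$, uniformly in $k\in\mathbb Z$, $$\begin{aligned}\rho_x(k)={}&\frac{2}{\ln2}\ln\varepsilon+\Bigl(-3+\frac{2}{\ln2}\ln\pi\Bigr)+\frac{1}{\ln2}\varepsilon+\frac1{\ln2}\Bigl(\frac14+\frac{7\pi^2}{24}\Bigr)\varepsilon^2+\frac1{\ln2}\Bigl(\frac1{12}+\frac{7\pi^2}{24}\Bigr)\varepsilon^3\\&+\frac{8}{3\ln2}\Bigl(\frac{\pi^2}{8}\Bigr)^{\frac{\ln3}{\ln2}}\cos\Bigl[\frac{\ln3}{\ln2}(2k+1)\pi\Bigr]\varepsilon^{2\frac{\ln3}{\ln2}}+o\bigl(\varepsilon^{2\frac{\ln3}{\ln2}}\bigr),\\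 \rho_y(k)={}&\frac{(2k+1)\pi}{\ln2}+\frac{8}{3\ln2}\Bigl(\frac{\pi^2}{8}\Bigr)^{\frac{\ln3}{\ln2}}\sin\Bigl[\frac{\ln3}{\ln2}(2k+1)\pi\Bigr]\varepsilon^{2\frac{\ln3}{\ln2}}+o\bigl(\varepsilon^{2\frac{\ln3}{\ln2}}\bigr).\end{aligned}$$ In particular, $\rho_x(k)\to-\infty$ for every $k$, and $\rho_y(k)\to\frac{(2k+1)\pi}{\ln2}$ uniformly in $k$: the imaginary parts become equidistant, on the lattice $\frac{(2\mathbb Z+1)\pi}{\ln 2}$. -/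

import Mathlib

open Filter Topology

/-- The lattice `L_Δ = 2ℤ ∪ (2ℤ + 2Δ/(1+Δ))`, of unit density, whose nearest-neighbour distances
alternate between `2/(1+Δ)` and `2Δ/(1+Δ)`. -/
def alternatingLattice (Δ : ℝ) : Set ℝ :=
  Set.range (fun n : ℤ => 2 * (n : ℝ)) ∪ Set.range (fun n : ℤ => 2 * (n : ℝ) + 2 * Δ / (1 + Δ))

/-- The Riesz energy per point of `L_Δ`, for a real exponent `s > 1`:
`(1/4) * ∑_{k ∈ {0, 2Δ/(1+Δ)}} ∑_{p ∈ L_Δ, p ≠ k} 1/|p - k|^s`. -/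
noncomputable def energyPerPoint (s Δ : ℝ) : ℝ :=
  (1 / 4) *
    ((∑' p : ↥(alternatingLattice Δ \ {0}), 1 / |(p : ℝ) - 0| ^ s) +
      ∑' p : ↥(alternatingLattice Δ \ {2 * Δ / (1 + Δ)}), 1 / |(p : ℝ) - 2 * Δ / (1 + Δ)| ^ s)

/-- The lattice energy `E(s, Δ)` for `0 < Δ ≤ 1` and complex `s ≠ 1`, through the (analytically
continued) Riemann and Hurwitz zeta functions:
`E(s, Δ) = 2^{-s} ζ(s) + 2^{-s-1} (ζ(s, 1/(1+Δ)) + ζ(s, Δ/(1+Δ)))`.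
The value at the pole `s = 1` is meaningless and is never used. -/
noncomputable def latticeEnergy (s : ℂ) (Δ : ℝ) : ℂ :=
  1 / (2 : ℂ) ^ s * riemannZeta s +
    1 / (2 : ℂ) ^ (s + 1) *
      (HurwitzZeta.hurwitzZeta ((1 / (1 + Δ) : ℝ) : UnitAddCircle) s +
        HurwitzZeta.hurwitzZeta ((Δ / (1 + Δ) : ℝ) : UnitAddCircle) s)

/-- The zero set `Z_Δ` of `E(·, Δ)` in `ℂ \ {1}`. -/
def energyZeros (Δ : ℝ) : Set ℂ := {s | s ≠ 1 ∧ latticeEnergy s Δ = 0}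

/-- `E(·, Δ)` is holomorphic on `ℂ \ {1}`. -/
theorem differentiableAt_latticeEnergy (Δ : ℝ) {s : ℂ} (hs : s ≠ 1) :
    DifferentiableAt ℂ (fun z => latticeEnergy z Δ) s := by
  have h2 : (2 : ℂ) ≠ 0 := two_ne_zero
  have hp : ∀ z : ℂ, (2 : ℂ) ^ z ≠ 0 := fun z => by simp [Complex.cpow_eq_zero_iff]
  have a1 : DifferentiableAt ℂ (fun z : ℂ => (2 : ℂ) ^ z) s :=
    differentiableAt_id.const_cpow (Or.inl h2)
  have a2 : DifferentiableAt ℂ (fun z : ℂ => (2 : ℂ) ^ (z + 1)) s :=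
    (differentiableAt_id.add_const 1).const_cpow (Or.inl h2)
  exact (((differentiableAt_const 1).div a1 (hp s)).mul (differentiableAt_riemannZeta hs)).add
    (((differentiableAt_const 1).div a2 (hp (s + 1))).mul
      ((HurwitzZeta.differentiableAt_hurwitzZeta _ hs).add
        (HurwitzZeta.differentiableAt_hurwitzZeta _ hs)))

/-- For real `s > 1`, `E(s, Δ)` is the energy per point of `L_Δ`; so `latticeEnergy · Δ` is its
analytic continuation. -/
theorem latticeEnergy_ofReal {s Δ : ℝ} (hs : 1 < s) (hΔ : 0 < Δ) :
    latticeEnergy (s : ℂ) Δ = (energyPerPoint s Δ : ℂ) := by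
  set d : ℝ := 2 * Δ / (1 + Δ) with hd
  have hd0 : 0 < d := by positivity
  have hd2 : d < 2 := by rw [hd, div_lt_iff₀ (by positivity)]; linarith
  have hs0 : s ≠ 0 := by linarith
  -- sums over the two sublattices
  have key : ∀ a : ℝ, ∃ W : ℝ, (W : ℂ) = 2 * HurwitzZeta.hurwitzZetaEven (a : UnitAddCircle) s ∧
      HasSum (fun n : ℤ => 1 / |2 * (n : ℝ) + 2 * a| ^ s) (W / 2 ^ s) := by
    intro a
    have h := (HurwitzZeta.hasSum_int_hurwitzZetaEven a (s := (s : ℂ)) (by simpa using hs)).mul_left 2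
    have e : (fun n : ℤ => (2 : ℂ) * (1 / ((|(n : ℝ) + a| : ℝ) : ℂ) ^ (s : ℂ) / 2)) =
        fun n : ℤ => ((1 / |(n : ℝ) + a| ^ s : ℝ) : ℂ) := by
      funext n
      rw [← Complex.ofReal_cpow (abs_nonneg _)]
      push_cast
      ring
    rw [e] at h
    have hre := Complex.hasSum_re h
    refine ⟨(2 * HurwitzZeta.hurwitzZetaEven (a : UnitAddCircle) s).re, ?_, ?_⟩
    · exact (Complex.hasSum_ofReal.mpr hre).unique (by simpa using h)
    · refine (hre.div_const ((2 : ℝ) ^ s)).congr_fun fun n => ?_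
      rw [show 2 * (n : ℝ) + 2 * a = 2 * (n + a) by ring, abs_mul,
        Real.mul_rpow (by positivity) (abs_nonneg _), Complex.ofReal_re]
      simp [div_eq_mul_inv, mul_comm]
  have hinj : ∀ c : ℝ, Function.Injective (fun n : ℤ => 2 * (n : ℝ) + c) := by
    intro c m n h
    have : (m : ℝ) = n := by simp only at h; linarith
    exact_mod_cast this
  have hdisj : Disjoint (Set.range (fun n : ℤ => 2 * (n : ℝ)))
      (Set.range (fun n : ℤ => 2 * (n : ℝ) + d)) := by
    rw [Set.disjoint_left]
    rintro _ ⟨m, rfl⟩ ⟨n, hn⟩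
    simp only at hn
    have h1 : (0 : ℝ) < ((m - n : ℤ) : ℝ) := by push_cast; linarith
    have h2 : ((m - n : ℤ) : ℝ) < 1 := by push_cast; linarith
    have h1' : 0 < m - n := by exact_mod_cast h1
    have h2' : m - n < 1 := by exact_mod_cast h2
    omega
  have site : ∀ (k A B : ℝ), HasSum (fun n : ℤ => 1 / |2 * (n : ℝ) - k| ^ s) A →
      HasSum (fun n : ℤ => 1 / |2 * (n : ℝ) + d - k| ^ s) B →
      ∑' p : ↥(alternatingLattice Δ \ {k}), 1 / |(p : ℝ) - k| ^ s = A + B := by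
    intro k A B hA hB
    have i0 : Function.Injective (fun n : ℤ => 2 * (n : ℝ)) := by simpa using hinj 0
    have hA' : HasSum ((fun p : ℝ => 1 / |p - k| ^ s) ∘
        ((↑) : ↥(Set.range (fun n : ℤ => 2 * (n : ℝ))) → ℝ)) A :=
      (i0.hasSum_range_iff (f := fun p : ℝ => 1 / |p - k| ^ s)).mpr hA
    have hB' : HasSum ((fun p : ℝ => 1 / |p - k| ^ s) ∘
        ((↑) : ↥(Set.range (fun n : ℤ => 2 * (n : ℝ) + d)) → ℝ)) B :=
      ((hinj d).hasSum_range_iff (f := fun p : ℝ => 1 / |p - k| ^ s)).mpr hB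
    have hU := hasSum_subtype_iff_indicator.mp (hA'.add_disjoint hdisj hB')
    rw [tsum_subtype (alternatingLattice Δ \ {k}) (fun p : ℝ => 1 / |p - k| ^ s)]
    rw [← hU.tsum_eq]
    congr 1
    funext p
    by_cases hp : p = k
    · subst hp
      simp [Set.indicator, Real.zero_rpow hs0]
    · have hm : p ∈ alternatingLattice Δ \ {k} ↔ p ∈ alternatingLattice Δ :=
        ⟨fun h => h.1, fun h => ⟨h, hp⟩⟩
      by_cases hL : p ∈ alternatingLattice Δ
      · rw [Set.indicator_of_mem (hm.mpr hL)]
        exact (Set.indicator_of_mem (s := alternatingLattice Δ) hL (fun p : ℝ => 1 / |p - k| ^ s)).symm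
      · rw [Set.indicator_of_notMem (fun h => hL (hm.mp h))]
        exact (Set.indicator_of_notMem (s := alternatingLattice Δ) hL (fun p : ℝ => 1 / |p - k| ^ s)).symm
  obtain ⟨W0, e0, h0⟩ := key 0
  obtain ⟨W1, e1, h1⟩ := key (d / 2)
  obtain ⟨W2, e2, h2⟩ := key (-(d / 2))
  have s0 := site 0 _ _ (by simpa using h0) (by convert h1 using 5; ring)
  have s1 := site d _ _ (by convert h2 using 5; ring) (by convert h0 using 5; ring)
  have c1 : ((Δ / (1 + Δ) : ℝ) : UnitAddCircle) = ((d / 2 : ℝ) : UnitAddCircle) := by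
    congr 1; rw [hd]; ring
  have c2 : ((1 / (1 + Δ) : ℝ) : UnitAddCircle) = -((d / 2 : ℝ) : UnitAddCircle) := by
    have : (1 / (1 + Δ) : ℝ) = -(d / 2) + 1 := by rw [hd]; field_simp; ring
    rw [this, AddCircle.coe_add_period, AddCircle.coe_neg]
  have c3 : ((-(d / 2) : ℝ) : UnitAddCircle) = -((d / 2 : ℝ) : UnitAddCircle) := AddCircle.coe_neg ..
  rw [c3, HurwitzZeta.hurwitzZetaEven_neg] at e2
  rw [energyPerPoint, ← hd, s0, s1, latticeEnergy, c1, c2]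
  have hz : HurwitzZeta.hurwitzZetaEven ((0 : ℝ) : UnitAddCircle) s = riemannZeta s := by
    rw [← HurwitzZeta.hurwitzZetaEven_zero]; rfl
  rw [hz] at e0
  have hev := HurwitzZeta.hurwitzZetaEven_eq ((d / 2 : ℝ) : UnitAddCircle) s
  have h2s : (2 : ℂ) ^ (s : ℂ) ≠ 0 := by simp [Complex.cpow_eq_zero_iff]
  have hsum : HurwitzZeta.hurwitzZeta (-((d / 2 : ℝ) : UnitAddCircle)) s +
      HurwitzZeta.hurwitzZeta ((d / 2 : ℝ) : UnitAddCircle) s =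
      2 * HurwitzZeta.hurwitzZetaEven ((d / 2 : ℝ) : UnitAddCircle) s := by
    rw [hev]; ring
  rw [hsum, Complex.cpow_add _ _ two_ne_zero, Complex.cpow_one]
  push_cast
  rw [e0, e1, e2, Complex.ofReal_cpow (by norm_num)]
  push_cast
  field_simp
  ring

/-! For `re s < 0` the functional equation turns `ζ(s)` and the even Hurwitz zeta function into
Dirichlet series with a common reflection factor. Hence `E(s, 1 - ε)` is that factor, whose zeros
are the trivial zeros, times `D(v) = ∑ c_n n ^ v` with `v = s - 1`, where `c_n` is `cos² (n θ)` for
even `n` and `sin² (n θ)` for odd `n`, and `θ ~ π ε / 4` (`latticeEnergy_eq_dualSeries`). At `θ = 0`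
only even `n` survive and `D(v) = 2 ^ v ζ(-v)` has no zeros, so zeros of `D` must escape to `re v =
-∞`: on a fixed strip the perturbation is uniformly small (`eventually_dualSeries_ne_zero`).

Far to the left the terms `n = 1` and `n = 2` dominate: `D(v) = sin² θ (1 + A) + cos² (2 θ) 2 ^ v (1
+ B)` with small `A`, `B`. Taking logarithms gives one equation for each integer `k`, `v log 2 =
L(θ) + (2 k + 1) π i + P(v)`, where `P` is a contraction; so each `k` has exactly one solution
(`dualSeries_eq_zero_iff`, `existsUnique_fixedPoint`). At a solution `2 ^ v = -θ² + O(θ⁴)` and `P(v)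
= 8 · 3 ^ v - 2 ^ v + O(θ⁴)`. The term `-2 ^ v` contributes `θ²` to the smooth part. The term `3 ^ v
= exp ((log 3 / log 2) · v log 2)` has size `θ ^ (2 log 3 / log 2)` and a phase depending on `k`: it
is the oscillating term. All constants are independent of `k` (`isBigO_branchZero_sub`).

To the right, `E(s, 1) = ζ(s)`, and `E(s, 1 - ε) - ζ(s)` is a sum of second differences, which tends
to `0` uniformly on bounded sets in `re s > -3/4` (`eventually_norm_latticeEnergy_sub_le`). For `re
s ≥ 4` and bounded `im s` the two nearest neighbours dominate the energy
(`latticeEnergy_ne_zero_of_le_re`). Compactness then puts the remaining zeros near those of `ζ`, and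
the maximum principle gives the converse. -/

open Filter Topology Asymptotics

/-! ### Reflection to a dual Dirichlet series -/

/-- The angle `π δ`, where `Δ/(1+Δ) = 1/2 - δ` for `Δ = 1 - ε`. -/
noncomputable def latticeAngle (ε : ℝ) : ℝ := Real.pi * ε / (2 * (2 - ε))

/-- The coefficients `cos² (n θ)` (`n` even) and `sin² (n θ)` (`n` odd). -/
noncomputable def angleCoeff (θ : ℝ) (n : ℕ) : ℝ :=
  if Even n then Real.cos (n * θ) ^ 2 else Real.sin (n * θ) ^ 2

/-- The Dirichlet series dual to the lattice energy, in the variable `v = s - 1`. -/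
noncomputable def dualSeries (θ : ℝ) (v : ℂ) : ℂ :=
  ∑' n : ℕ, (angleCoeff θ (n + 1) : ℂ) * ((n + 1 : ℕ) : ℂ) ^ v

theorem latticeEnergy_eq_hurwitzZetaEven {Δ : ℝ} (hΔ : 1 + Δ ≠ 0) (s : ℂ) :
    latticeEnergy s Δ = 1 / (2 : ℂ) ^ s *
      (riemannZeta s + HurwitzZeta.hurwitzZetaEven ((Δ / (1 + Δ) : ℝ) : UnitAddCircle) s) := by
  have h1 : ((1 / (1 + Δ) : ℝ) : UnitAddCircle) = -((Δ / (1 + Δ) : ℝ) : UnitAddCircle) := by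
    have : (1 / (1 + Δ) : ℝ) = -(Δ / (1 + Δ)) + 1 := by field_simp; ring
    rw [this, AddCircle.coe_add_period, AddCircle.coe_neg]
  have h2 : (2 : ℂ) ^ s ≠ 0 := by simp [Complex.cpow_eq_zero_iff]
  rw [latticeEnergy, HurwitzZeta.hurwitzZetaEven_eq, h1, Complex.cpow_add _ _ two_ne_zero,
    Complex.cpow_one]
  field_simp
  ring

theorem offset_eq {ε : ℝ} (hε : ε < 2) :
    (1 - ε) / (1 + (1 - ε)) = 1 / 2 - latticeAngle ε / Real.pi := by
  have h : 2 - ε ≠ 0 := by linarith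
  have h' : 1 + (1 - ε) ≠ 0 := by linarith
  rw [latticeAngle]
  field_simp [Real.pi_ne_zero]
  ring

theorem angleCoeff_eq (θ : ℝ) (n : ℕ) :
    1 + Real.cos (2 * Real.pi * (1 / 2 - θ / Real.pi) * n) = 2 * angleCoeff θ n := by
  have hx : 2 * Real.pi * (1 / 2 - θ / Real.pi) * n = n * Real.pi - 2 * (n * θ) := by
    field_simp [Real.pi_ne_zero]
  rw [hx, angleCoeff]
  split_ifs with h
  · obtain ⟨m, rfl⟩ := h
    rw [show ((m + m : ℕ) : ℝ) * Real.pi - 2 * ((m + m : ℕ) * θ) =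
      (m : ℝ) * (2 * Real.pi) - 2 * ((m + m : ℕ) * θ) by push_cast; ring,
      Real.cos_nat_mul_two_pi_sub, Real.cos_two_mul]
    ring
  · obtain ⟨m, rfl⟩ := Nat.not_even_iff_odd.mp h
    rw [show ((2 * m + 1 : ℕ) : ℝ) * Real.pi - 2 * ((2 * m + 1 : ℕ) * θ) =
      (Real.pi - 2 * ((2 * m + 1 : ℕ) * θ)) + (m : ℝ) * (2 * Real.pi) by push_cast; ring,
      Real.cos_add_nat_mul_two_pi, Real.cos_pi_sub, Real.cos_two_mul, Real.sin_sq]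
    ring

theorem angleCoeff_nonneg (θ : ℝ) (n : ℕ) : 0 ≤ angleCoeff θ n := by
  rw [angleCoeff]; split_ifs <;> positivity

theorem angleCoeff_le_one (θ : ℝ) (n : ℕ) : angleCoeff θ n ≤ 1 := by
  rw [angleCoeff]; split_ifs
  · exact Real.cos_sq_le_one _
  · exact Real.sin_sq_le_one _

theorem norm_natSucc_cpow (n : ℕ) (v : ℂ) :
    ‖((n + 1 : ℕ) : ℂ) ^ v‖ = ((n + 1 : ℕ) : ℝ) ^ v.re :=
  Complex.norm_natCast_cpow_of_pos n.succ_pos v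

theorem summable_natSucc_rpow {x : ℝ} (hx : x < -1) :
    Summable fun n : ℕ => ((n + 1 : ℕ) : ℝ) ^ x :=
  (summable_nat_add_iff 1).mpr (Real.summable_nat_rpow.mpr hx)

theorem summable_mul_natSucc_cpow {c : ℕ → ℂ} (hc : ∀ n, ‖c n‖ ≤ 1) {v : ℂ} (hv : v.re < -1) :
    Summable fun n : ℕ => c n * ((n + 1 : ℕ) : ℂ) ^ v := by
  refine Summable.of_norm_bounded (summable_natSucc_rpow hv) fun n => ?_
  rw [norm_mul, norm_natSucc_cpow]
  exact mul_le_of_le_one_left (by positivity) (hc n)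

theorem norm_angleCoeff_le_one (θ : ℝ) (n : ℕ) : ‖(angleCoeff θ n : ℂ)‖ ≤ 1 := by
  rw [Complex.norm_real, Real.norm_of_nonneg (angleCoeff_nonneg _ _)]
  exact angleCoeff_le_one _ _

theorem riemannZeta_add_cosZeta (θ : ℝ) {v : ℂ} (hv : v.re < -1) :
    riemannZeta (-v) + HurwitzZeta.cosZeta ((1 / 2 - θ / Real.pi : ℝ) : UnitAddCircle) (-v) =
      2 * dualSeries θ v := by
  have hv' : 1 < (-v).re := by simp; linarith
  have h0 := HurwitzZeta.hasSum_nat_cosZeta 0 hv'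
  have h1 := HurwitzZeta.hasSum_nat_cosZeta (1 / 2 - θ / Real.pi) hv'
  have hz : HurwitzZeta.cosZeta ((0 : ℝ) : UnitAddCircle) (-v) = riemannZeta (-v) := by
    rw [← HurwitzZeta.cosZeta_zero]; rfl
  rw [hz] at h0
  have h := h0.add h1
  have hv0 : -v ≠ 0 := by
    rintro h; rw [h] at hv'; simp at hv'; linarith
  rw [← hasSum_nat_add_iff' 1] at h
  simp only [Finset.range_one, Finset.sum_singleton, Nat.cast_zero, Complex.zero_cpow hv0, div_zero,
    add_zero, sub_zero] at h
  rw [← h.tsum_eq, dualSeries, ← tsum_mul_left]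
  refine tsum_congr fun n => ?_
  rw [← mul_assoc, show (2 : ℂ) * (angleCoeff θ (n + 1) : ℂ) =
    ((2 * angleCoeff θ (n + 1) : ℝ) : ℂ) by push_cast; ring, ← angleCoeff_eq]
  rw [Complex.cpow_neg]
  simp
  ring

/-- The reflection formulas of `ζ` and of the even Hurwitz zeta function share their gamma and
cosine factors, so only the sum of the two dual series depends on `ε`. -/
theorem latticeEnergy_eq_dualSeries {ε : ℝ} (hε : ε < 2) {s : ℂ} (hs : s.re < 0) :
    latticeEnergy s (1 - ε) = 1 / (2 : ℂ) ^ s *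
      (2 * (2 * Real.pi) ^ (-(1 - s)) * Complex.Gamma (1 - s) *
        Complex.cos (Real.pi * (1 - s) / 2)) * (2 * dualSeries (latticeAngle ε) (s - 1)) := by
  have hn : ∀ n : ℕ, 1 - s ≠ -n := fun n h => by
    have := congrArg Complex.re h
    simp at this
    have : (0 : ℝ) ≤ n := n.cast_nonneg
    linarith
  have h1 : 1 - s ≠ 1 := fun h => by
    have := congrArg Complex.re h
    simp at this
    linarith
  have e1 := riemannZeta_one_sub hn h1
  have e2 := HurwitzZeta.hurwitzZetaEven_one_sub
    ((1 / 2 - latticeAngle ε / Real.pi : ℝ) : UnitAddCircle) hn (Or.inr h1)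
  rw [sub_sub_cancel] at e1 e2
  rw [latticeEnergy_eq_hurwitzZetaEven (by linarith), offset_eq hε, e1, e2,
    ← riemannZeta_add_cosZeta _ (v := s - 1) (by simp; linarith), neg_sub]
  ring_nf

theorem cos_half_pi_mul_eq_zero_iff {s : ℂ} (hs : s.re < 0) :
    Complex.cos (Real.pi * (1 - s) / 2) = 0 ↔ ∃ n : ℕ, s = -2 * ((n : ℂ) + 1) := by
  rw [Complex.cos_eq_zero_iff]
  have hpi : (Real.pi : ℂ) ≠ 0 := by exact_mod_cast Real.pi_ne_zero
  constructor
  · rintro ⟨k, hk⟩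
    have hk' : s = -2 * (k : ℂ) := by
      have : (Real.pi : ℂ) * (s + 2 * k) = 0 := by linear_combination (-2) * hk
      rcases mul_eq_zero.mp this with h | h
      · exact absurd h hpi
      · linear_combination h
    have hk0 : 0 < k := by
      rw [hk'] at hs
      simp at hs
      exact hs
    obtain ⟨n, rfl⟩ := Int.eq_succ_of_zero_lt hk0
    exact ⟨n, by rw [hk']; push_cast; ring⟩
  · rintro ⟨n, rfl⟩
    exact ⟨n + 1, by push_cast; ring⟩

theorem reflection_factor_ne_zero {s : ℂ} (hs : s.re < 0) :
    2 * (2 * (Real.pi : ℂ)) ^ (-(1 - s)) * Complex.Gamma (1 - s) ≠ 0 := by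
  have hpi : (Real.pi : ℂ) ≠ 0 := by exact_mod_cast Real.pi_ne_zero
  refine mul_ne_zero (mul_ne_zero two_ne_zero ?_) (Complex.Gamma_ne_zero_of_re_pos (by simp; linarith))
  simp [Complex.cpow_eq_zero_iff, hpi]

theorem latticeEnergy_eq_zero_iff {ε : ℝ} (hε : ε < 2) {s : ℂ} (hs : s.re < 0) :
    latticeEnergy s (1 - ε) = 0 ↔
      (∃ n : ℕ, s = -2 * ((n : ℂ) + 1)) ∨ dualSeries (latticeAngle ε) (s - 1) = 0 := by
  have h2 : (2 : ℂ) ^ s ≠ 0 := by simp [Complex.cpow_eq_zero_iff]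
  have h := reflection_factor_ne_zero hs
  rw [latticeEnergy_eq_dualSeries hε hs, ← cos_half_pi_mul_eq_zero_iff hs]
  simp only [ne_eq, mul_eq_zero, two_ne_zero, false_or, not_or] at h
  simp only [mul_eq_zero, div_eq_zero_iff, one_ne_zero, h2, h.1, h.2, false_or, two_ne_zero]

/-- In the reflection formula `ζ(1 - s)` does not vanish, since `re (1 - s) > 1`; only the cosine
can. -/
theorem riemannZeta_eq_zero_of_re_neg {s : ℂ} (hs : s.re < 0) (h : riemannZeta s = 0) :
    ∃ n : ℕ, s = -2 * ((n : ℂ) + 1) := by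
  have hn : ∀ n : ℕ, 1 - s ≠ -n := fun n h => by
    have := congrArg Complex.re h
    simp at this
    have : (0 : ℝ) ≤ n := n.cast_nonneg
    linarith
  have h1 : 1 - s ≠ 1 := fun h => by
    have := congrArg Complex.re h
    simp at this
    linarith
  have e1 := riemannZeta_one_sub hn h1
  rw [sub_sub_cancel, h] at e1
  rw [← cos_half_pi_mul_eq_zero_iff hs]
  have h3 : riemannZeta (1 - s) ≠ 0 := riemannZeta_ne_zero_of_one_le_re (by simp; linarith)
  have h4 := reflection_factor_ne_zero hs
  rcases mul_eq_zero.mp e1.symm with h5 | h5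
  · exact (mul_eq_zero.mp h5).resolve_left h4
  · exact absurd h5 h3

/-! ### No zeros of the dual series in a fixed vertical strip -/

/-- Splitting off the value at `θ = 0`. -/
theorem dualSeries_eq (θ : ℝ) {v : ℂ} (hv : v.re < -1) :
    ∃ r : ℂ, dualSeries θ v = 2 ^ v * riemannZeta (-v) + r ∧
      ‖r‖ ≤ ∑' n : ℕ, Real.sin ((n + 1 : ℕ) * θ) ^ 2 * ((n + 1 : ℕ) : ℝ) ^ v.re := by
  -- The index `n` stands for the integer `n + 1`. These are the coefficients at `θ = 0`, and for
  -- either parity they differ from those at `θ` by `sin² ((n + 1) θ)` in absolute value.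
  set c : ℕ → ℂ := fun n => if Even (n + 1) then 1 else 0 with hc
  have hz : HasSum (fun n : ℕ => c n * ((n + 1 : ℕ) : ℂ) ^ v) (2 ^ v * riemannZeta (-v)) := by
    have h1 : HasSum (fun n : ℕ => ((n + 1 : ℕ) : ℂ) ^ v) (riemannZeta (-v)) := by
      rw [zeta_eq_tsum_one_div_nat_add_one_cpow (by simp; linarith)]
      have e : ∀ n : ℕ, 1 / ((n : ℂ) + 1) ^ (-v) = 1 * ((n + 1 : ℕ) : ℂ) ^ v := fun n => by
        rw [Complex.cpow_neg]; simp
      simp_rw [e]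
      exact (summable_mul_natSucc_cpow (c := fun _ => 1) (by simp) hv).hasSum.congr_fun
        fun n => (one_mul _).symm
    rw [← zero_add (2 ^ v * riemannZeta (-v))]
    refine HasSum.even_add_odd (f := fun n : ℕ => c n * ((n + 1 : ℕ) : ℂ) ^ v) ?_ ?_
    · refine hasSum_zero.congr_fun fun k => ?_
      simp [hc, Nat.even_add_one]
    · refine (h1.mul_left (2 ^ v)).congr_fun fun k => ?_
      have : Even (2 * k + 1 + 1) := ⟨k + 1, by ring⟩
      simp only [hc, this, if_true, one_mul]
      rw [show ((2 * k + 1 + 1 : ℕ) : ℂ) = ((2 : ℕ) : ℂ) * ((k + 1 : ℕ) : ℂ) by push_cast; ring,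
        Complex.natCast_mul_natCast_cpow]
      simp
  have hd := (summable_mul_natSucc_cpow (c := fun n => (angleCoeff θ (n + 1) : ℂ))
    (fun n => norm_angleCoeff_le_one θ _) hv).hasSum
  have hr := hd.sub hz
  refine ⟨_, (add_sub_cancel _ _).symm, ?_⟩
  change ‖dualSeries θ v - _‖ ≤ _
  rw [show dualSeries θ v - 2 ^ v * riemannZeta (-v) = _ from hr.tsum_eq.symm]
  have hb : ∀ n : ℕ, ‖(angleCoeff θ (n + 1) : ℂ) * ((n + 1 : ℕ) : ℂ) ^ v
      - c n * ((n + 1 : ℕ) : ℂ) ^ v‖ = Real.sin ((n + 1 : ℕ) * θ) ^ 2 * ((n + 1 : ℕ) : ℝ) ^ v.re := by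
    intro n
    rw [← sub_mul, norm_mul, norm_natSucc_cpow]
    congr 1
    simp only [hc, angleCoeff]
    split_ifs
    · rw [show ((Real.cos ((n + 1 : ℕ) * θ) ^ 2 : ℝ) : ℂ) - 1 =
        ((Real.cos ((n + 1 : ℕ) * θ) ^ 2 - 1 : ℝ) : ℂ) by push_cast; ring, Complex.norm_real,
        Real.cos_sq', Real.norm_eq_abs, sub_sub_cancel_left, abs_neg, abs_of_nonneg (by positivity)]
    · rw [sub_zero, Complex.norm_real, Real.norm_of_nonneg (by positivity)]
  rw [← tsum_congr hb]
  refine norm_tsum_le_tsum_norm ?_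
  simp_rw [hb]
  refine Summable.of_nonneg_of_le (fun n => by positivity) (fun n => ?_) (summable_natSucc_rpow hv)
  exact mul_le_of_le_one_left (by positivity) (Real.sin_sq_le_one _)

/-- `1 / ζ` is the Dirichlet series of the Möbius function, which is bounded by `∑ n ^ (-τ)`. -/
theorem exists_le_norm_riemannZeta {τ : ℝ} (hτ : 1 < τ) :
    ∃ c : ℝ, 0 < c ∧ ∀ w : ℂ, τ ≤ w.re → c ≤ ‖riemannZeta w‖ := by
  have hS := Real.summable_nat_rpow.mpr (show -τ < -1 by linarith)
  set S := ∑' n : ℕ, (n : ℝ) ^ (-τ)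
  have hS0 : 0 ≤ S := tsum_nonneg fun n => by positivity
  refine ⟨1 / (S + 1), by positivity, fun w hw => ?_⟩
  have h1 := ArithmeticFunction.LSeries_zeta_mul_Lseries_moebius (s := w) (by linarith)
  rw [ArithmeticFunction.LSeries_zeta_eq_riemannZeta (by linarith)] at h1
  have hM : ‖LSeries (fun n => (ArithmeticFunction.moebius n : ℂ)) w‖ ≤ S := by
    refine tsum_of_norm_bounded hS.hasSum fun n => ?_
    rcases Nat.eq_zero_or_pos n with rfl | hn
    · simp only [LSeries.term_zero, norm_zero]; positivity
    rw [LSeries.term_of_ne_zero hn.ne', norm_div, Complex.norm_natCast_cpow_of_pos hn,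
      Real.rpow_neg (by positivity), ← one_div]
    have hn1 : (1 : ℝ) ≤ n := by exact_mod_cast hn
    refine div_le_div₀ zero_le_one ?_ (by positivity) (Real.rpow_le_rpow_of_exponent_le hn1 hw)
    rw [Complex.norm_intCast]
    exact_mod_cast ArithmeticFunction.abs_moebius_le_one
  have h2 : ‖riemannZeta w‖ * ‖LSeries (fun n => (ArithmeticFunction.moebius n : ℂ)) w‖ = 1 := by
    rw [← norm_mul, h1, norm_one]
  rw [div_le_iff₀ (by positivity), ← h2]
  gcongr
  linarith

/-- The value at `θ = 0` is bounded below on the strip, and the bound for the remainder depends on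
`re v` alone, so the comparison is uniform in the unbounded direction `im v`. -/
theorem eventually_dualSeries_ne_zero (X : ℝ) {σ : ℝ} (hσ : σ < 0) :
    ∀ᶠ θ in 𝓝 (0 : ℝ), ∀ v : ℂ, -X ≤ v.re → v.re ≤ σ - 1 → dualSeries θ v ≠ 0 := by
  obtain ⟨c, hc, hζ⟩ := exists_le_norm_riemannZeta (show 1 < 1 - σ by linarith)
  have hsum := summable_natSucc_rpow (show σ - 1 < -1 by linarith)
  have ht : Tendsto (fun θ : ℝ => ∑' n : ℕ,
      Real.sin ((n + 1 : ℕ) * θ) ^ 2 * ((n + 1 : ℕ) : ℝ) ^ (σ - 1)) (𝓝 0) (𝓝 (∑' n : ℕ, 0)) := by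
    refine tendsto_tsum_of_dominated_convergence hsum (fun n => ?_)
      (Eventually.of_forall fun θ n => ?_)
    · have : ContinuousAt (fun θ : ℝ => Real.sin ((n + 1 : ℕ) * θ) ^ 2 *
        ((n + 1 : ℕ) : ℝ) ^ (σ - 1)) 0 := by fun_prop
      simpa [ContinuousAt] using this
    · rw [Real.norm_of_nonneg (by positivity)]
      exact mul_le_of_le_one_left (by positivity) (Real.sin_sq_le_one _)
  rw [tsum_zero] at ht
  have hpos : 0 < (2 : ℝ) ^ (-X) * c := by positivity
  filter_upwards [ht.eventually (gt_mem_nhds hpos)] with θ hθ v hv1 hv2 h0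
  have hv : v.re < -1 := by linarith
  obtain ⟨r, hr, hrb⟩ := dualSeries_eq θ hv
  rw [h0] at hr
  have hr' : ‖(2 : ℂ) ^ v * riemannZeta (-v)‖ = ‖r‖ := by
    rw [← norm_neg r]; congr 1; linear_combination -hr
  have h2 : ‖(2 : ℂ) ^ v‖ = 2 ^ v.re := by
    have := Complex.norm_natCast_cpow_of_pos (n := 2) two_pos v
    simpa using this
  rw [norm_mul, h2] at hr'
  have hlow : (2 : ℝ) ^ (-X) * c ≤ ‖r‖ := by
    rw [← hr']
    have : (2 : ℝ) ^ (-X) ≤ 2 ^ v.re := Real.rpow_le_rpow_of_exponent_le (by norm_num) hv1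
    have := hζ (-v) (by simp; linarith)
    gcongr
  have hup : ‖r‖ ≤ ∑' n : ℕ, Real.sin ((n + 1 : ℕ) * θ) ^ 2 * ((n + 1 : ℕ) : ℝ) ^ (σ - 1) := by
    have hle : ∀ n : ℕ, Real.sin ((n + 1 : ℕ) * θ) ^ 2 * ((n + 1 : ℕ) : ℝ) ^ v.re ≤
        Real.sin ((n + 1 : ℕ) * θ) ^ 2 * ((n + 1 : ℕ) : ℝ) ^ (σ - 1) := fun n => by
      gcongr
      simp
    have hs : Summable fun n : ℕ =>
        Real.sin ((n + 1 : ℕ) * θ) ^ 2 * ((n + 1 : ℕ) : ℝ) ^ (σ - 1) :=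
      Summable.of_nonneg_of_le (fun n => by positivity)
        (fun n => mul_le_of_le_one_left (by positivity) (Real.sin_sq_le_one _)) hsum
    exact hrb.trans ((hs.of_nonneg_of_le (fun n => by positivity) hle).tsum_le_tsum hle hs)
  linarith

/-! ### Tail series in the half-plane `re v ≤ -10` -/

/-- The series `∑ a m (m + 2) ^ v`. -/
noncomputable def tailSeries (a : ℕ → ℝ) (v : ℂ) : ℂ :=
  ∑' m : ℕ, (a m : ℂ) * ((m + 2 : ℕ) : ℂ) ^ v

theorem norm_tsum_le_of_le_div_sq {b : ℕ → ℂ} {K : ℝ} (hK : 0 ≤ K)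
    (hb : ∀ m, ‖b m‖ ≤ K * (1 / ((m + 2 : ℕ) : ℝ) ^ 2)) : Summable b ∧ ‖∑' m, b m‖ ≤ K := by
  -- Removing the terms `0` (zero by the convention `1 / 0 = 0`) and `1` leaves `π² / 6 - 1 ≤ 1`.
  have h := (hasSum_nat_add_iff' 2).mpr hasSum_zeta_two
  refine ⟨Summable.of_norm_bounded (h.summable.mul_left K) hb, ?_⟩
  refine (tsum_of_norm_bounded (h.mul_left K) hb).trans (mul_le_of_le_one_right hK ?_)
  have := Real.pi_lt_d2
  have := Real.pi_pos
  norm_num [Finset.sum_range_succ]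
  nlinarith

/-- Spare decay of `n ^ x` is traded for powers of the first index `N`, keeping `n ^ (-2)` for
summation. With `N = 2` and `k = 5` it yields small constants; with `N = 4` and `k = 0`, the decay
`4 ^ (re v)`. -/
theorem rpow_le_mul_inv_sq {n : ℕ} {N : ℕ} (hN : 0 < N) (hn : N ≤ n) {x y : ℝ} (hxy : x ≤ y)
    {k j : ℕ} (hy : y ≤ -(k + j + 2 : ℕ)) :
    (n : ℝ) ^ j * (n : ℝ) ^ x ≤ (N : ℝ) ^ (x - y) * ((1 / (N : ℝ) ^ k) * (1 / (n : ℝ) ^ 2)) := by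
  have hN' : (0 : ℝ) < N := by exact_mod_cast hN
  have hn' : (0 : ℝ) < n := by exact_mod_cast hN.trans_le hn
  have hn1 : (1 : ℝ) ≤ n := by exact_mod_cast (Nat.succ_le_of_lt hN).trans hn
  have hNn : (N : ℝ) ≤ n := by exact_mod_cast hn
  have e : (n : ℝ) ^ j * (n : ℝ) ^ x = (n : ℝ) ^ (x - y) * ((n : ℝ) ^ j * (n : ℝ) ^ y) := by
    rw [Real.rpow_sub hn']; field_simp
  have h1 : (n : ℝ) ^ (x - y) ≤ (N : ℝ) ^ (x - y) :=
    Real.rpow_le_rpow_of_nonpos hN' hNn (by linarith)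
  have h2 : (n : ℝ) ^ j * (n : ℝ) ^ y ≤ (1 / (N : ℝ) ^ k) * (1 / (n : ℝ) ^ 2) := by
    calc (n : ℝ) ^ j * (n : ℝ) ^ y ≤ (n : ℝ) ^ j * (n : ℝ) ^ (-((k + j + 2 : ℕ) : ℝ)) := by
          gcongr
      _ = (1 / (n : ℝ) ^ k) * (1 / (n : ℝ) ^ 2) := by
          rw [Real.rpow_neg hn'.le, Real.rpow_natCast, pow_add, pow_add]; field_simp
      _ ≤ _ := by gcongr
  rw [e]
  exact mul_le_mul h1 h2 (by positivity) (by positivity)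

section

variable {a : ℕ → ℝ}

theorem summable_tailSeries (ha : ∀ m, |a m| ≤ 2 * ((m + 2 : ℕ) : ℝ) ^ 2) {v : ℂ}
    (hv : v.re ≤ -10) :
    Summable (fun m : ℕ => (a m : ℂ) * ((m + 2 : ℕ) : ℂ) ^ v) ∧ ‖tailSeries a v‖ ≤ 1 / 16 := by
  refine norm_tsum_le_of_le_div_sq (by norm_num) fun m => ?_
  rw [norm_mul, Complex.norm_real, norm_natSucc_cpow, Real.norm_eq_abs]
  have h := rpow_le_mul_inv_sq (n := m + 2) two_pos (by omega) (le_refl v.re) (k := 5) (j := 2)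
    (by push_cast; linarith)
  rw [sub_self, Real.rpow_zero, one_mul] at h
  calc |a m| * ((m + 1 + 1 : ℕ) : ℝ) ^ v.re
      ≤ 2 * ((m + 2 : ℕ) : ℝ) ^ 2 * ((m + 2 : ℕ) : ℝ) ^ v.re :=
        mul_le_mul_of_nonneg_right (ha m) (by positivity)
    _ = 2 * (((m + 2 : ℕ) : ℝ) ^ 2 * ((m + 2 : ℕ) : ℝ) ^ v.re) := by ring
    _ ≤ _ := mul_le_mul_of_nonneg_left h zero_le_two
    _ = _ := by push_cast; ring

theorem norm_natCast_cpow_sub_le {n : ℕ} (hn : 0 < n) {y : ℝ} {v w : ℂ} (hv : v.re ≤ y)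
    (hw : w.re ≤ y) : ‖(n : ℂ) ^ v - (n : ℂ) ^ w‖ ≤ (n : ℝ) * (n : ℝ) ^ y * ‖v - w‖ := by
  have hn1 : (1 : ℝ) ≤ n := by exact_mod_cast hn
  have hn0 : (n : ℂ) ≠ 0 := by exact_mod_cast hn.ne'
  refine Convex.norm_image_sub_le_of_norm_hasDerivWithin_le (f := fun z : ℂ => (n : ℂ) ^ z)
    (f' := fun z => (n : ℂ) ^ z * Complex.log n) (s := {z : ℂ | z.re ≤ y})
    (fun z _ => ?_) (fun z hz => ?_) (convex_halfSpace_re_le y) hw hv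
  · simpa using ((hasDerivAt_id z).const_cpow (Or.inl hn0)).hasDerivWithinAt
  · rw [norm_mul, Complex.norm_natCast_cpow_of_pos hn, ← Complex.natCast_log, Complex.norm_real,
      Real.norm_of_nonneg (Real.log_nonneg hn1), mul_comm]
    have := (Real.log_le_sub_one_of_pos (show (0 : ℝ) < n by linarith))
    have := Real.rpow_le_rpow_of_exponent_le hn1 (show z.re ≤ y from hz)
    gcongr
    linarith

theorem norm_tailSeries_sub_le (ha : ∀ m, |a m| ≤ 2 * ((m + 2 : ℕ) : ℝ) ^ 2) {v w : ℂ}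
    (hv : v.re ≤ -10) (hw : w.re ≤ -10) :
    ‖tailSeries a v - tailSeries a w‖ ≤ 1 / 16 * ‖v - w‖ := by
  rw [tailSeries, tailSeries,
    ← (summable_tailSeries ha hv).1.tsum_sub (summable_tailSeries ha hw).1]
  refine (norm_tsum_le_of_le_div_sq (by positivity) fun m => ?_).2
  rw [← mul_sub, norm_mul, Complex.norm_real, Real.norm_eq_abs]
  -- The threshold `-10` is used up exactly: `n²` from the coefficients and `n` from the derivative
  -- make `j = 3`, two powers serve summability, and `k = 5` gives the constant `2 / 2 ^ 5 = 1 /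
  -- 16`.
  have h := rpow_le_mul_inv_sq (n := m + 2) two_pos (by omega) (le_refl (-10)) (k := 5) (j := 3)
    (by norm_num)
  rw [sub_self, Real.rpow_zero, one_mul] at h
  have h1 := norm_natCast_cpow_sub_le (n := m + 2) (by omega) hv hw
  calc _ ≤ (2 * ((m + 2 : ℕ) : ℝ) ^ 2) * (((m + 2 : ℕ) : ℝ) * ((m + 2 : ℕ) : ℝ) ^ (-10 : ℝ) * ‖v - w‖) :=
        mul_le_mul (ha m) h1 (by positivity) (by positivity)
    _ = 2 * ‖v - w‖ * (((m + 2 : ℕ) : ℝ) ^ 3 * ((m + 2 : ℕ) : ℝ) ^ (-10 : ℝ)) := by ring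
    _ ≤ 2 * ‖v - w‖ * (1 / ((2 : ℕ) : ℝ) ^ 5 * (1 / ((m + 2 : ℕ) : ℝ) ^ 2)) := by gcongr
    _ = _ := by push_cast; ring

/-- All but the first two terms of a tail series are of the size of `4 ^ v`. -/
theorem norm_tailSeries_sub_two_terms_le (ha : ∀ m, |a m| ≤ 2 * ((m + 2 : ℕ) : ℝ) ^ 2) {v : ℂ}
    (hv : v.re ≤ -10) :
    ‖tailSeries a v - (a 0 * 2 ^ v + a 1 * 3 ^ v)‖ ≤ 2 * (4 : ℝ) ^ (v.re + 10) := by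
  have hs := (summable_tailSeries ha hv).1
  rw [tailSeries, ← hs.sum_add_tsum_nat_add 2]
  simp only [Finset.sum_range_succ, Finset.range_zero, Finset.sum_empty, zero_add]
  norm_num only [Nat.cast_ofNat, Nat.reduceAdd]
  rw [add_sub_cancel_left]
  refine (norm_tsum_le_of_le_div_sq (by positivity) fun m => ?_).2
  rw [norm_mul, Complex.norm_real, Complex.norm_natCast_cpow_of_pos (by omega), Real.norm_eq_abs]
  have h := rpow_le_mul_inv_sq (n := m + 2 + 2) (N := 4) (by norm_num) (by omega) hv (k := 0)
    (j := 2) (by norm_num)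
  rw [pow_zero, div_one, one_mul] at h
  have h0 : (0 : ℝ) ≤ ((m + 2 + 2 : ℕ) : ℝ) ^ v.re := by positivity
  have h1 := mul_le_mul_of_nonneg_right (ha (m + 2)) h0
  calc _ ≤ _ := h1
    _ = 2 * (((m + 2 + 2 : ℕ) : ℝ) ^ 2 * ((m + 2 + 2 : ℕ) : ℝ) ^ v.re) := by ring
    _ ≤ _ := mul_le_mul_of_nonneg_left h zero_le_two
    _ = 2 * (4 : ℝ) ^ (v.re + 10) * (1 / ((m + 2 + 2 : ℕ) : ℝ) ^ 2) := by
      rw [sub_neg_eq_add]; push_cast; ring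
    _ ≤ _ := by gcongr; omega

end

/-! ### Factorization of the dual series and the logarithmic equation -/

theorem abs_sin_nat_mul_le (n : ℕ) (θ : ℝ) : |Real.sin (n * θ)| ≤ n * |Real.sin θ| := by
  induction n with
  | zero => simp
  | succ n ih =>
    rw [Nat.cast_succ, add_mul, one_mul, Real.sin_add]
    calc _ ≤ |Real.sin (n * θ) * Real.cos θ| + |Real.cos (n * θ) * Real.sin θ| := abs_add_le _ _
      _ ≤ |Real.sin (n * θ)| * 1 + 1 * |Real.sin θ| := by
        rw [abs_mul, abs_mul]
        gcongr
        · exact Real.abs_cos_le_one _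
        · exact Real.abs_cos_le_one _
      _ ≤ _ := by linarith

/-- Coefficients of the odd terms of the dual series, relative to the first one. -/
noncomputable def oddCoeff (θ : ℝ) (m : ℕ) : ℝ :=
  if Even m then 0 else Real.sin ((m + 2 : ℕ) * θ) ^ 2 / Real.sin θ ^ 2

/-- Coefficients of the even terms of the dual series, relative to the first one. -/
noncomputable def evenCoeff (θ : ℝ) (m : ℕ) : ℝ :=
  Real.cos (2 * (m + 2 : ℕ) * θ) ^ 2 / Real.cos (2 * θ) ^ 2

section

variable {θ : ℝ}

theorem sin_pos_of_small (h0 : 0 < θ) (h1 : θ ≤ 1 / 4) : 0 < Real.sin θ :=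
  Real.sin_pos_of_pos_of_lt_pi h0 (by linarith [Real.pi_gt_three])

theorem half_le_cos_sq (h0 : 0 < θ) (h1 : θ ≤ 1 / 4) : 1 / 2 ≤ Real.cos (2 * θ) ^ 2 := by
  have := Real.one_sub_sq_div_two_le_cos (x := 2 * θ)
  have h2 : 7 / 8 ≤ Real.cos (2 * θ) := by nlinarith
  nlinarith

/-- Division by `sin² θ` is harmless because `|sin (n θ)| ≤ n |sin θ|`; the resulting bound is
uniform in `θ`. -/
theorem abs_oddCoeff_le (h0 : 0 < θ) (h1 : θ ≤ 1 / 4) (m : ℕ) :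
    |oddCoeff θ m| ≤ 2 * ((m + 2 : ℕ) : ℝ) ^ 2 := by
  rw [oddCoeff]
  split_ifs
  · simp; positivity
  have hs := sin_pos_of_small h0 h1
  rw [abs_of_nonneg (by positivity), div_le_iff₀ (by positivity)]
  have h := abs_sin_nat_mul_le (m + 2) θ
  rw [abs_of_pos hs] at h
  have := pow_le_pow_left₀ (abs_nonneg _) h 2
  rw [sq_abs, mul_pow] at this
  have h3 : 0 ≤ ((m + 2 : ℕ) : ℝ) ^ 2 * Real.sin θ ^ 2 := by positivity
  linarith

theorem abs_evenCoeff_le (h0 : 0 < θ) (h1 : θ ≤ 1 / 4) (m : ℕ) :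
    |evenCoeff θ m| ≤ 2 * ((m + 2 : ℕ) : ℝ) ^ 2 := by
  have hc := half_le_cos_sq h0 h1
  rw [evenCoeff, abs_of_nonneg (by positivity), div_le_iff₀ (by linarith)]
  have h2 := Real.cos_sq_le_one (2 * (m + 2 : ℕ) * θ)
  have h3 : (1 : ℝ) ≤ ((m + 2 : ℕ) : ℝ) ^ 2 := by
    have : (1 : ℝ) ≤ ((m + 2 : ℕ) : ℝ) := by push_cast; linarith [(m.cast_nonneg : (0 : ℝ) ≤ m)]
    nlinarith
  nlinarith

theorem dualSeries_eq_tailSeries (h0 : 0 < θ) (h1 : θ ≤ 1 / 4) {v : ℂ} (hv : v.re ≤ -10) :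
    dualSeries θ v = (Real.sin θ ^ 2 : ℝ) * (1 + tailSeries (oddCoeff θ) v) +
      (Real.cos (2 * θ) ^ 2 : ℝ) * 2 ^ v * (1 + tailSeries (evenCoeff θ) v) := by
  have hs := sin_pos_of_small h0 h1
  have hc := half_le_cos_sq h0 h1
  have hA := (summable_tailSeries (abs_oddCoeff_le h0 h1) hv).1.hasSum
  have hB := (summable_tailSeries (abs_evenCoeff_le h0 h1) hv).1.hasSum
  -- Even indices `n` are the odd integers `n + 1`. The integer `1` is split off and the rest is
  -- indexed by `m + 2`.
  have hodd : HasSum (fun n : ℕ => if Even n then (angleCoeff θ (n + 1) : ℂ) *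
      ((n + 1 : ℕ) : ℂ) ^ v else 0) ((Real.sin θ ^ 2 : ℝ) * (1 + tailSeries (oddCoeff θ) v)) := by
    rw [← hasSum_nat_add_iff' 1]
    have e : (Real.sin θ ^ 2 : ℝ) * (1 + tailSeries (oddCoeff θ) v) -
        ∑ i ∈ Finset.range 1, (if Even i then (angleCoeff θ (i + 1) : ℂ) *
          ((i + 1 : ℕ) : ℂ) ^ v else 0) = (Real.sin θ ^ 2 : ℝ) * tailSeries (oddCoeff θ) v := by
      simp [angleCoeff]; ring
    rw [e]
    refine (hA.mul_left ((Real.sin θ ^ 2 : ℝ) : ℂ)).congr_fun fun n => ?_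
    rw [oddCoeff, angleCoeff]
    by_cases h : Even n
    · simp [h, Nat.even_add_one]
    · have h' : ¬ Even (n + 1 + 1) := by simpa [Nat.even_add_one] using h
      have h'' : Even (n + 1) := by simpa [Nat.even_add_one] using h
      rw [if_pos h'', if_neg h', if_neg h, ← mul_assoc, ← Complex.ofReal_mul,
        mul_div_cancel₀ _ (by positivity)]
  -- The even integers are `2 j`; the factor `2 ^ v` comes out, `j = 1` is split off, and `j = m +
  -- 2` indexes the rest.
  have heven : HasSum (fun n : ℕ => if Even n then 0 else (angleCoeff θ (n + 1) : ℂ) *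
      ((n + 1 : ℕ) : ℂ) ^ v)
      (0 + (Real.cos (2 * θ) ^ 2 : ℝ) * 2 ^ v * (1 + tailSeries (evenCoeff θ) v)) := by
    refine HasSum.even_add_odd (f := fun n : ℕ => if Even n then 0 else
      (angleCoeff θ (n + 1) : ℂ) * ((n + 1 : ℕ) : ℂ) ^ v) ?_ ?_
    · refine hasSum_zero.congr_fun fun k => ?_
      simp
    · rw [← hasSum_nat_add_iff' 1]
      have e : (Real.cos (2 * θ) ^ 2 : ℝ) * 2 ^ v * (1 + tailSeries (evenCoeff θ) v) -
          ∑ i ∈ Finset.range 1, (if Even (2 * i + 1) then 0 else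
            (angleCoeff θ (2 * i + 1 + 1) : ℂ) * ((2 * i + 1 + 1 : ℕ) : ℂ) ^ v) =
          (Real.cos (2 * θ) ^ 2 : ℝ) * 2 ^ v * tailSeries (evenCoeff θ) v := by
        simp [angleCoeff]; norm_num; ring
      rw [e]
      refine (hB.mul_left (((Real.cos (2 * θ) ^ 2 : ℝ) : ℂ) * 2 ^ v)).congr_fun fun n => ?_
      have h1 : ¬ Even (2 * (n + 1) + 1) := by simp
      have h2 : Even (2 * (n + 1) + 1 + 1) := ⟨n + 2, by ring⟩
      rw [if_neg h1, angleCoeff, if_pos h2, evenCoeff,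
        show ((2 * (n + 1) + 1 + 1 : ℕ) : ℂ) = ((2 : ℕ) : ℂ) * ((n + 2 : ℕ) : ℂ) by push_cast; ring,
        Complex.natCast_mul_natCast_cpow,
        show ((2 * (n + 1) + 1 + 1 : ℕ) : ℝ) = 2 * (n + 2 : ℕ) by push_cast; ring]
      have hc' : ((Real.cos (2 * θ) : ℝ) : ℂ) ≠ 0 := by
        intro h
        have : Real.cos (2 * θ) = 0 := by exact_mod_cast h
        rw [this] at hc; norm_num at hc
      push_cast at hc' ⊢
      field_simp
  have hall := hodd.add heven
  rw [zero_add] at hall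
  rw [dualSeries, ← hall.tsum_eq]
  refine tsum_congr fun n => ?_
  split_ifs <;> simp

/-- The logarithm of the modulus of the leading part of `2 ^ v` at a zero. -/
noncomputable def leadingLog (θ : ℝ) : ℝ := Real.log (Real.sin θ ^ 2 / Real.cos (2 * θ) ^ 2)

/-- The perturbation in the logarithmic form of the equation `dualSeries θ v = 0`. -/
noncomputable def perturbation (θ : ℝ) (v : ℂ) : ℂ :=
  Complex.log (1 + tailSeries (oddCoeff θ) v) - Complex.log (1 + tailSeries (evenCoeff θ) v)

/-- Vanishing means `2 ^ v = -(sin² θ / cos² (2 θ)) (1 + A) / (1 + B)`. The sign supplies `π i`, and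
the periods of `exp` supply the branch number `k`. -/
theorem dualSeries_eq_zero_iff (h0 : 0 < θ) (h1 : θ ≤ 1 / 4) {v : ℂ} (hv : v.re ≤ -10) :
    dualSeries θ v = 0 ↔ ∃ k : ℤ, v * Real.log 2 =
      leadingLog θ + (2 * k + 1) * Real.pi * Complex.I + perturbation θ v := by
  have hs := sin_pos_of_small h0 h1
  have hc := half_le_cos_sq h0 h1
  have hA := (summable_tailSeries (abs_oddCoeff_le h0 h1) hv).2
  have hB := (summable_tailSeries (abs_evenCoeff_le h0 h1) hv).2
  have hne : ∀ z : ℂ, ‖z‖ ≤ 1 / 16 → 1 + z ≠ 0 := fun z hz h => by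
    have : z = -1 := by linear_combination h
    rw [this] at hz; norm_num at hz
  rw [dualSeries_eq_tailSeries h0 h1 hv, perturbation]
  set A := tailSeries (oddCoeff θ) v
  set B := tailSeries (evenCoeff θ) v
  have hq : 0 < Real.sin θ ^ 2 / Real.cos (2 * θ) ^ 2 := by positivity
  have hexp : Complex.exp (leadingLog θ + Real.pi * Complex.I +
      (Complex.log (1 + A) - Complex.log (1 + B))) =
      -((Real.sin θ ^ 2 / Real.cos (2 * θ) ^ 2 : ℝ) : ℂ) * ((1 + A) / (1 + B)) := by
    rw [Complex.exp_add, Complex.exp_add, Complex.exp_pi_mul_I, Complex.exp_sub,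
      Complex.exp_log (hne A hA), Complex.exp_log (hne B hB), ← Complex.ofReal_exp, leadingLog,
      Real.exp_log hq]
    ring
  have h2 : (2 : ℂ) ^ v = Complex.exp (v * Real.log 2) := by
    rw [Complex.cpow_def_of_ne_zero two_ne_zero, Complex.ofReal_log zero_le_two, mul_comm]; simp
  have hstep : (∃ k : ℤ, v * Real.log 2 = leadingLog θ + (2 * k + 1) * Real.pi * Complex.I +
      (Complex.log (1 + A) - Complex.log (1 + B))) ↔
      (2 : ℂ) ^ v = -((Real.sin θ ^ 2 / Real.cos (2 * θ) ^ 2 : ℝ) : ℂ) * ((1 + A) / (1 + B)) := by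
    rw [h2, ← hexp, Complex.exp_eq_exp_iff_exists_int]
    refine exists_congr fun k => ?_
    constructor <;> intro h <;> linear_combination h
  rw [hstep]
  have hs' : ((Real.sin θ : ℝ) : ℂ) ≠ 0 := by exact_mod_cast hs.ne'
  have hc' : ((Real.cos (2 * θ) : ℝ) : ℂ) ≠ 0 := by
    intro h
    have : Real.cos (2 * θ) = 0 := by exact_mod_cast h
    rw [this] at hc; norm_num at hc
  have hBne := hne B hB
  push_cast at hc' hs' ⊢
  rw [← sub_eq_zero (a := (2 : ℂ) ^ v)]
  have e : (2 : ℂ) ^ v - -(Complex.sin θ ^ 2 / Complex.cos (2 * θ) ^ 2) * ((1 + A) / (1 + B)) =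
      (Complex.sin θ ^ 2 * (1 + A) + Complex.cos (2 * θ) ^ 2 * 2 ^ v * (1 + B)) /
        (Complex.cos (2 * θ) ^ 2 * (1 + B)) := by
    field_simp
    ring
  rw [e, div_eq_zero_iff]
  simp [hc', hBne]

theorem norm_log_one_add_sub_le {z w : ℂ} (hz : ‖z‖ ≤ 1 / 16) (hw : ‖w‖ ≤ 1 / 16) :
    ‖Complex.log (1 + z) - Complex.log (1 + w)‖ ≤ 2 * ‖z - w‖ := by
  have hmem : ∀ {u : ℂ}, ‖u‖ ≤ 1 / 16 → u ∈ Metric.closedBall (0 : ℂ) (1 / 16) := by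
    intro u hu; simpa using hu
  refine Convex.norm_image_sub_le_of_norm_hasDerivWithin_le (f := fun z : ℂ => Complex.log (1 + z))
    (f' := fun z => 1 / (1 + z)) (s := Metric.closedBall (0 : ℂ) (1 / 16))
    (fun u hu => ?_) (fun u hu => ?_) (convex_closedBall _ _) (hmem hw) (hmem hz)
  · rw [mem_closedBall_zero_iff] at hu
    refine (HasDerivAt.clog ((hasDerivAt_id u).const_add 1) ?_).hasDerivWithinAt
    exact Complex.mem_slitPlane_of_norm_lt_one (by simp; linarith)
  · rw [mem_closedBall_zero_iff] at hu
    have h1 : 15 / 16 ≤ ‖1 + u‖ := by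
      have := norm_sub_le (1 + u) u
      rw [add_sub_cancel_right, norm_one] at this
      linarith
    rw [norm_div, norm_one, div_le_iff₀ (by linarith)]
    linarith

theorem norm_perturbation_le (h0 : 0 < θ) (h1 : θ ≤ 1 / 4) {v : ℂ} (hv : v.re ≤ -10) :
    ‖perturbation θ v‖ ≤ 1 := by
  have hA := (summable_tailSeries (abs_oddCoeff_le h0 h1) hv).2
  have hB := (summable_tailSeries (abs_evenCoeff_le h0 h1) hv).2
  have h2 := Complex.norm_log_one_add_half_le_self (z := tailSeries (oddCoeff θ) v) (by linarith)
  have h3 := Complex.norm_log_one_add_half_le_self (z := tailSeries (evenCoeff θ) v) (by linarith)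
  have := norm_sub_le (Complex.log (1 + tailSeries (oddCoeff θ) v))
    (Complex.log (1 + tailSeries (evenCoeff θ) v))
  rw [perturbation]
  linarith

theorem norm_perturbation_sub_le (h0 : 0 < θ) (h1 : θ ≤ 1 / 4) {v w : ℂ} (hv : v.re ≤ -10)
    (hw : w.re ≤ -10) : ‖perturbation θ v - perturbation θ w‖ ≤ 1 / 4 * ‖v - w‖ := by
  have ha := abs_oddCoeff_le h0 h1
  have hb := abs_evenCoeff_le h0 h1
  have h2 := norm_log_one_add_sub_le (summable_tailSeries ha hv).2 (summable_tailSeries ha hw).2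
  have h3 := norm_log_one_add_sub_le (summable_tailSeries hb hv).2 (summable_tailSeries hb hw).2
  have h4 := norm_tailSeries_sub_le ha hv hw
  have h5 := norm_tailSeries_sub_le hb hv hw
  rw [perturbation, perturbation, sub_sub_sub_comm]
  refine (norm_sub_le _ _).trans ?_
  linarith

end

/-! ### Solving the branch equations by contraction -/

/-- The map `v ↦ (z + H v) / log 2` preserves `re v ≤ -10`, because `(-8 + 1) / log 2 < -10`, and
has Lipschitz constant at most `1 / (4 log 2) < 1 / 2`. -/
theorem existsUnique_fixedPoint {H : ℂ → ℂ} (hH : ∀ v : ℂ, v.re ≤ -10 → ‖H v‖ ≤ 1)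
    (hL : ∀ v w : ℂ, v.re ≤ -10 → w.re ≤ -10 → ‖H v - H w‖ ≤ 1 / 4 * ‖v - w‖) {z : ℂ}
    (hz : z.re ≤ -8) : ∃! v : ℂ, v.re ≤ -10 ∧ v * Real.log 2 = z + H v := by
  have l1 := Real.log_two_gt_d9
  have l2 := Real.log_two_lt_d9
  have hl : ((Real.log 2 : ℝ) : ℂ) ≠ 0 := by
    norm_cast; linarith
  set f : ℂ → ℂ := fun v => (z + H v) / (Real.log 2 : ℝ) with hf
  set S : Set ℂ := {v : ℂ | v.re ≤ -10}
  have hmaps : Set.MapsTo f S S := by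
    intro v hv
    have h1 := (Complex.abs_re_le_norm (H v)).trans (hH v hv)
    have h2 := (abs_le.mp h1).2
    change ((z + H v) / ((Real.log 2 : ℝ) : ℂ)).re ≤ -10
    rw [Complex.div_ofReal_re, div_le_iff₀ (by linarith), Complex.add_re]
    linarith
  have hlip : ∀ v ∈ S, ∀ w ∈ S, ‖f v - f w‖ ≤ 1 / 2 * ‖v - w‖ := by
    intro v hv w hw
    have e : f v - f w = (H v - H w) / (Real.log 2 : ℝ) := by simp only [hf]; ring
    rw [e, norm_div, Complex.norm_real, Real.norm_of_nonneg (by linarith), div_le_iff₀ (by linarith)]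
    have := hL v w hv hw
    have := norm_nonneg (v - w)
    nlinarith
  have hcl : IsClosed S := isClosed_le Complex.continuous_re continuous_const
  have hcontr : ContractingWith (1 / 2) (hmaps.restrict f S S) := by
    refine ⟨by rw [← NNReal.coe_lt_coe]; norm_num, LipschitzWith.of_dist_le_mul fun v w => ?_⟩
    rw [Subtype.dist_eq, Subtype.dist_eq, dist_eq_norm, dist_eq_norm]
    simpa using hlip v v.2 w w.2
  have hmem : (-10 : ℂ) ∈ S := by simp [S]
  obtain ⟨y, hyS, hy, -⟩ := hcontr.exists_fixedPoint' hcl.isComplete hmaps hmem (edist_ne_top _ _)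
  have hiff : ∀ v : ℂ, v * Real.log 2 = z + H v ↔ f v = v := fun v => by
    rw [hf, div_eq_iff hl, eq_comm]
  refine ⟨y, ⟨hyS, (hiff y).mpr hy⟩, fun w hw => ?_⟩
  have h1 := hlip w hw.1 y hyS
  rw [(hiff w).mp hw.2, hy] at h1
  have h2 : ‖w - y‖ = 0 := by
    have := norm_nonneg (w - y)
    linarith
  exact sub_eq_zero.mp (norm_eq_zero.mp h2)

/-! ### Expansion of the non-oscillating part -/

theorem abs_log_one_add_sub_le {x : ℝ} (hx : |x| ≤ 1 / 2) : |Real.log (1 + x) - x| ≤ 2 * x ^ 2 := by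
  have h := Real.abs_log_sub_add_sum_range_le (x := -x) (by rw [abs_neg]; linarith) 1
  simp only [Finset.sum_range_succ, Finset.range_zero, Finset.sum_empty] at h
  norm_num at h
  rw [show Real.log (1 + x) - x = -x + Real.log (1 + x) by ring]
  refine h.trans ?_
  rw [div_le_iff₀ (by linarith)]
  nlinarith [sq_nonneg x]

/-- Here `2 log (sin θ / θ)` contributes `-θ² / 3` and `-2 log (cos (2 θ))` contributes `4 θ²`,
whence `11 / 3`. -/
theorem abs_leadingLog_sub_le {θ : ℝ} (h0 : 0 < θ) (h1 : θ ≤ 1 / 4) :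
    |leadingLog θ - (2 * Real.log θ + 11 / 3 * θ ^ 2)| ≤ 44 * θ ^ 4 := by
  have hs := sin_pos_of_small h0 h1
  have hc2 := half_le_cos_sq h0 h1
  have hc : Real.cos (2 * θ) ≠ 0 := fun h => by rw [h] at hc2; norm_num at hc2
  have hθ2 : θ ^ 2 ≤ 1 / 16 := by nlinarith
  have hθ4 : θ ^ 4 ≤ 1 / 16 * θ ^ 2 := by nlinarith [sq_nonneg θ]
  have hsb := Real.sin_bound (x := θ) (by rw [abs_of_pos h0]; linarith)
  have hcb := Real.cos_bound (x := 2 * θ) (by rw [abs_of_pos (by linarith)]; linarith)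
  obtain ⟨x, hx⟩ : ∃ x, x = Real.sin θ / θ - 1 := ⟨_, rfl⟩
  obtain ⟨y, hy⟩ : ∃ y, y = Real.cos (2 * θ) - 1 := ⟨_, rfl⟩
  have hsx : Real.sin θ = θ * (1 + x) := by rw [hx]; field_simp; ring
  have hcy : Real.cos (2 * θ) = 1 + y := by rw [hy]; ring
  have hxb : |x + θ ^ 2 / 6| ≤ θ ^ 4 := by
    have e : Real.sin θ - (θ - θ ^ 3 / 6) = θ * (x + θ ^ 2 / 6) := by rw [hsx]; ring
    rw [e, abs_mul, abs_of_pos h0] at hsb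
    have : |x + θ ^ 2 / 6| ≤ θ ^ 4 / 100 := by
      refine le_of_mul_le_mul_left (hsb.trans (le_of_eq ?_)) h0
      ring
    have : 0 ≤ θ ^ 4 := by positivity
    linarith
  have hyb : |y + 2 * θ ^ 2| ≤ θ ^ 4 := by
    have e : Real.cos (2 * θ) - (1 - (2 * θ) ^ 2 / 2) = y + 2 * θ ^ 2 := by rw [hcy]; ring
    rw [e, abs_of_pos (a := 2 * θ) (by linarith)] at hcb
    refine hcb.trans ?_
    have : 0 ≤ θ ^ 4 := by positivity
    ring_nf at this ⊢
    linarith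
  rw [abs_le] at hxb hyb
  have hx1 : |x| ≤ θ ^ 2 := by rw [abs_le]; constructor <;> linarith [sq_nonneg θ]
  have hy1 : |y| ≤ 3 * θ ^ 2 := by rw [abs_le]; constructor <;> linarith [sq_nonneg θ]
  have hxl := abs_le.mp (abs_log_one_add_sub_le (x := x) (by linarith))
  have hyl := abs_le.mp (abs_log_one_add_sub_le (x := y) (by linarith))
  have hx2 : x ^ 2 ≤ θ ^ 4 := by
    have := pow_le_pow_left₀ (abs_nonneg _) hx1 2
    rw [sq_abs] at this
    linarith [show (θ ^ 2) ^ 2 = θ ^ 4 by ring]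
  have hy2 : y ^ 2 ≤ 9 * θ ^ 4 := by
    have := pow_le_pow_left₀ (abs_nonneg _) hy1 2
    rw [sq_abs] at this
    linarith [show (3 * θ ^ 2) ^ 2 = 9 * θ ^ 4 by ring]
  have hx0 : 1 + x ≠ 0 := fun h => by rw [hsx, h, mul_zero] at hs; exact lt_irrefl _ hs
  have e : leadingLog θ = 2 * Real.log θ + 2 * Real.log (1 + x) - 2 * Real.log (1 + y) := by
    rw [leadingLog, Real.log_div (by positivity) (by positivity), Real.log_pow, Real.log_pow,
      ← hcy, hsx, Real.log_mul h0.ne' hx0]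
    push_cast
    ring
  rw [e, abs_le]
  constructor <;> linarith

/-- The non-oscillating part of the expansion of the zeros, multiplied by `log 2`. -/
noncomputable def nonoscillatingPart (ε : ℝ) : ℝ :=
  2 * Real.log ε + 2 * Real.log (Real.pi / 4) + ε + (1 / 4 + 7 * Real.pi ^ 2 / 24) * ε ^ 2 +
    (1 / 12 + 7 * Real.pi ^ 2 / 24) * ε ^ 3

theorem latticeAngle_eq {ε : ℝ} (h : ε < 2) :
    latticeAngle ε = Real.pi / 4 * ε * (1 - ε / 2)⁻¹ := by
  have h1 : 2 - ε ≠ 0 := by linarith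
  have h2 : 1 - ε / 2 ≠ 0 := by linarith
  rw [latticeAngle]
  field_simp
  ring

theorem tendsto_latticeAngle : Tendsto latticeAngle (𝓝[>] 0) (𝓝[>] 0) := by
  refine tendsto_nhdsWithin_iff.mpr ⟨?_, ?_⟩
  · have : ContinuousAt latticeAngle 0 := by
      unfold latticeAngle
      refine ContinuousAt.div (by fun_prop) (by fun_prop) (by norm_num)
    have h := this.tendsto
    rw [show latticeAngle 0 = 0 by simp [latticeAngle]] at h
    exact h.mono_left nhdsWithin_le_nhds
  · filter_upwards [Ioo_mem_nhdsGT (zero_lt_one' ℝ)] with ε hε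
    have : 0 < 2 - ε := by linarith [hε.2]
    have := hε.1
    simp only [latticeAngle, Set.mem_Ioi]
    positivity

theorem latticeAngle_le {ε : ℝ} (h0 : 0 < ε) (h1 : ε ≤ 1) :
    0 < latticeAngle ε ∧ latticeAngle ε ≤ 2 * ε := by
  have h2 : 0 < 2 * (2 - ε) := by linarith
  refine ⟨by unfold latticeAngle; positivity, ?_⟩
  rw [latticeAngle, div_le_iff₀ h2]
  nlinarith [Real.pi_lt_d2, mul_nonneg h0.le (show 0 ≤ 4 - 4 * ε by linarith)]

theorem isBigO_latticeAngle : latticeAngle =O[𝓝[>] 0] fun ε : ℝ => ε := by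
  refine IsBigO.of_bound 2 ?_
  filter_upwards [Ioo_mem_nhdsGT (zero_lt_one' ℝ)] with ε hε
  have := latticeAngle_le hε.1 hε.2.le
  rw [Real.norm_of_nonneg this.1.le, Real.norm_of_nonneg hε.1.le]
  exact this.2

/-- The extra `θ²` is the contribution of `-2 ^ v` at a zero; it raises `11 / 3` to `14 / 3`, the
source of `7 π² / 24 = (14 / 3) (π² / 16)`. -/
theorem isBigO_leadingLog_latticeAngle :
    (fun ε => leadingLog (latticeAngle ε) + latticeAngle ε ^ 2 - nonoscillatingPart ε) =O[𝓝[>] 0]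
      fun ε : ℝ => ε ^ 4 := by
  have h1 : (fun θ => leadingLog θ - (2 * Real.log θ + 11 / 3 * θ ^ 2)) =O[𝓝[>] 0]
      fun θ : ℝ => θ ^ 4 := by
    refine IsBigO.of_bound 44 ?_
    filter_upwards [Ioo_mem_nhdsGT (show (0 : ℝ) < 1 / 4 by norm_num)] with θ hθ
    rw [Real.norm_eq_abs, Real.norm_of_nonneg (by positivity)]
    exact abs_leadingLog_sub_le hθ.1 hθ.2.le
  have h2 := (h1.comp_tendsto tendsto_latticeAngle).trans (isBigO_latticeAngle.pow 4)
  have h3 : (fun ε : ℝ => 2 * (-Real.log (1 - ε / 2) - (ε / 2 + (ε / 2) ^ 2 / 2 + (ε / 2) ^ 3 / 3)))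
      =O[𝓝[>] 0] fun ε : ℝ => ε ^ 4 := by
    refine IsBigO.of_bound 2 ?_
    filter_upwards [Ioo_mem_nhdsGT (zero_lt_one' ℝ)] with ε hε
    have h := Real.abs_log_sub_add_sum_range_le (x := ε / 2)
      (by rw [abs_of_pos (by linarith [hε.1])]; linarith [hε.2]) 3
    simp only [Finset.sum_range_succ, Finset.range_zero, Finset.sum_empty] at h
    rw [abs_of_pos (a := ε / 2) (by linarith [hε.1])] at h
    norm_num only [Nat.cast_zero, Nat.cast_one, Nat.cast_ofNat, zero_add, pow_one, div_one] at h
    rw [norm_mul, Real.norm_eq_abs, Real.norm_eq_abs, Real.norm_of_nonneg (by positivity),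
      abs_of_pos two_pos, ← abs_neg,
      show -(-Real.log (1 - ε / 2) - (ε / 2 + (ε / 2) ^ 2 / 2 + (ε / 2) ^ 3 / 3)) =
        ε / 2 + (ε / 2) ^ 2 / 2 + (ε / 2) ^ 3 / 3 + Real.log (1 - ε / 2) by ring]
    refine mul_le_mul_of_nonneg_left (h.trans ?_) zero_le_two
    rw [div_le_iff₀ (by linarith [hε.2])]
    have : 0 ≤ ε ^ 4 := by positivity
    nlinarith [hε.2]
  have h4 : (fun ε : ℝ => 14 / 3 * (latticeAngle ε ^ 2 - Real.pi ^ 2 / 16 * (ε ^ 2 + ε ^ 3)))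
      =O[𝓝[>] 0] fun ε : ℝ => ε ^ 4 := by
    -- This is the quotient by `ε⁴`, from `(1 - ε/2)⁻² - (1 + ε) = ε² (3/4 - ε/4) (1 - ε/2)⁻²`.
    have hcont : ContinuousAt (fun ε : ℝ =>
        14 / 3 * (Real.pi ^ 2 / 16 * ((3 / 4 - ε / 4) * ((1 - ε / 2)⁻¹) ^ 2))) 0 := by
      refine ContinuousAt.mul (by fun_prop) (ContinuousAt.mul (by fun_prop) (ContinuousAt.mul
        (by fun_prop) (ContinuousAt.pow (ContinuousAt.inv₀ (by fun_prop) (by norm_num)) _)))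
    have hb := (hcont.tendsto.isBigO_one ℝ).mono (nhdsWithin_le_nhds (s := Set.Ioi 0))
    have := hb.mul (isBigO_refl (fun ε : ℝ => ε ^ 4) (𝓝[>] 0))
    refine this.congr' ?_ (by simp)
    filter_upwards [Ioo_mem_nhdsGT (zero_lt_one' ℝ)] with ε hε
    rw [latticeAngle_eq (by linarith [hε.2])]
    have h : (1 - ε / 2)⁻¹ * (1 - ε / 2) = 1 := inv_mul_cancel₀ (by linarith [hε.2])
    linear_combination (-(14 / 3 * Real.pi ^ 2 / 16) * ε ^ 2 * (1 + ε) *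
      ((1 - ε / 2)⁻¹ * (1 - ε / 2) + 1)) * h
  refine ((h2.add h3).add h4).congr' ?_ EventuallyEq.rfl
  filter_upwards [Ioo_mem_nhdsGT (zero_lt_one' ℝ)] with ε hε
  have hε0 := hε.1
  have hlog : Real.log (latticeAngle ε) =
      Real.log (Real.pi / 4) + Real.log ε - Real.log (1 - ε / 2) := by
    have : 1 - ε / 2 ≠ 0 := by linarith [hε.2]
    rw [latticeAngle_eq (by linarith [hε.2]), Real.log_mul (by positivity) (inv_ne_zero this),
      Real.log_mul (by positivity) hε0.ne', Real.log_inv]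
    ring
  simp only [Function.comp, nonoscillatingPart, hlog]
  ring

/-! ### Expansion of a branch zero in powers of the angle -/

/-- The exponent `log 3 / log 2`. -/
noncomputable def logRatio : ℝ := Real.log 3 / Real.log 2

theorem one_lt_logRatio : 1 < logRatio := by
  rw [logRatio, one_lt_div (Real.log_pos one_lt_two)]
  exact Real.log_lt_log two_pos (by norm_num)

theorem logRatio_lt_two : logRatio < 2 := by
  rw [logRatio, div_lt_iff₀ (Real.log_pos one_lt_two),
    show (2 : ℝ) * Real.log 2 = Real.log (2 ^ 2) by rw [Real.log_pow]; norm_num]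
  exact Real.log_lt_log three_pos (by norm_num)

/-- `v` is a zero of the dual series in logarithmic form, with branch number `k`. -/
def IsBranchZero (θ : ℝ) (k : ℤ) (v : ℂ) : Prop :=
  v.re ≤ -10 ∧
    v * Real.log 2 = leadingLog θ + (2 * k + 1) * Real.pi * Complex.I + perturbation θ v

theorem exp_leadingLog {θ : ℝ} (h0 : 0 < θ) (h1 : θ ≤ 1 / 4) :
    Real.exp (leadingLog θ) = Real.sin θ ^ 2 / Real.cos (2 * θ) ^ 2 := by
  have := half_le_cos_sq h0 h1
  have := sin_pos_of_small h0 h1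
  exact Real.exp_log (by positivity)

/-- Real parts in the branch equation do not see `k`, so the bound is uniform in `k`. The constant
comes from `cos² (2 θ) ≥ 1 / 2` and `e < 3`. -/
theorem IsBranchZero.two_rpow_le {θ : ℝ} (h0 : 0 < θ) (h1 : θ ≤ 1 / 4) {k : ℤ} {v : ℂ}
    (h : IsBranchZero θ k v) : (2 : ℝ) ^ v.re ≤ 6 * θ ^ 2 := by
  have hp := (abs_le.mp ((Complex.abs_re_le_norm _).trans (norm_perturbation_le h0 h1 h.1))).2
  have hre := congrArg Complex.re h.2
  have e : v.re * Real.log 2 = leadingLog θ + (perturbation θ v).re := by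
    rw [Complex.re_mul_ofReal] at hre
    simpa using hre
  have hc := half_le_cos_sq h0 h1
  have hs := sin_pos_of_small h0 h1
  have hs2 : Real.sin θ ≤ θ := Real.sin_le h0.le
  rw [Real.rpow_def_of_pos two_pos, mul_comm, e, Real.exp_add, exp_leadingLog h0 h1]
  have h3 : Real.sin θ ^ 2 / Real.cos (2 * θ) ^ 2 ≤ 2 * θ ^ 2 := by
    rw [div_le_iff₀ (by linarith)]
    nlinarith
  have h4 : Real.exp (perturbation θ v).re ≤ 3 :=
    (Real.exp_le_exp.mpr hp).trans (by linarith [Real.exp_one_lt_d9])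
  calc _ ≤ (2 * θ ^ 2) * 3 := by gcongr
    _ = _ := by ring

theorem IsBranchZero.norm_two_cpow_le {θ : ℝ} (h0 : 0 < θ) (h1 : θ ≤ 1 / 4) {k : ℤ} {v : ℂ}
    (h : IsBranchZero θ k v) : ‖(2 : ℂ) ^ v‖ ≤ 6 * θ ^ 2 := by
  have e := Complex.norm_natCast_cpow_of_pos (n := 2) two_pos v
  push_cast at e
  rw [e]
  exact h.two_rpow_le h0 h1

theorem IsBranchZero.norm_three_cpow_le {θ : ℝ} (h0 : 0 < θ) (h1 : θ ≤ 1 / 4) {k : ℤ} {v : ℂ}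
    (h : IsBranchZero θ k v) : ‖(3 : ℂ) ^ v‖ ≤ 6 * θ ^ 2 := by
  have e := Complex.norm_natCast_cpow_of_pos (n := 3) three_pos v
  push_cast at e
  rw [e]
  refine le_trans ?_ (h.two_rpow_le h0 h1)
  exact Real.rpow_le_rpow_of_nonpos two_pos (by norm_num) (by linarith [h.1])

theorem IsBranchZero.four_rpow_le {θ : ℝ} (h0 : 0 < θ) (h1 : θ ≤ 1 / 4) {k : ℤ} {v : ℂ}
    (h : IsBranchZero θ k v) : (4 : ℝ) ^ (v.re + 10) ≤ 4 ^ 10 * 36 * θ ^ 4 := by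
  have h2 := h.two_rpow_le h0 h1
  have e : (4 : ℝ) ^ v.re = ((2 : ℝ) ^ v.re) ^ 2 := by
    rw [← Real.rpow_natCast, ← Real.rpow_mul zero_le_two, mul_comm, Real.rpow_mul zero_le_two]
    norm_num
  rw [Real.rpow_add (by norm_num), e]
  have h3 : ((2 : ℝ) ^ v.re) ^ 2 ≤ (6 * θ ^ 2) ^ 2 := by gcongr
  have e2 : (4 : ℝ) ^ (10 : ℝ) = 4 ^ 10 := by
    rw [← Real.rpow_natCast]; norm_num
  rw [e2]
  nlinarith

theorem abs_oddCoeff_one_sub_le {θ : ℝ} (h0 : 0 < θ) (h1 : θ ≤ 1 / 4) :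
    oddCoeff θ 0 = 0 ∧ |oddCoeff θ 1 - 9| ≤ 24 * θ ^ 2 := by
  have hs := sin_pos_of_small h0 h1
  have hs2 : Real.sin θ ≤ θ := Real.sin_le h0.le
  refine ⟨by simp [oddCoeff], ?_⟩
  -- `m = 1` is the integer `3`, so the triple-angle formula gives the limit `9`.
  have e : oddCoeff θ 1 = (3 - 4 * Real.sin θ ^ 2) ^ 2 := by
    rw [oddCoeff, if_neg (by simp)]
    have : ((1 + 2 : ℕ) : ℝ) * θ = 3 * θ := by norm_num
    rw [this, Real.sin_three_mul]
    field_simp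
  have h4 : Real.sin θ ^ 2 ≤ θ ^ 2 := by gcongr
  have h5 : Real.sin θ ^ 2 ≤ 1 := Real.sin_sq_le_one _
  rw [e, abs_le]
  constructor <;> nlinarith [sq_nonneg (Real.sin θ)]

theorem abs_evenCoeff_sub_le {θ : ℝ} (h0 : 0 < θ) (h1 : θ ≤ 1 / 4) (m : ℕ) (hm : m ≤ 1) :
    |evenCoeff θ m - 1| ≤ 80 * θ ^ 2 := by
  have hc := half_le_cos_sq h0 h1
  have key : ∀ x : ℝ, Real.sin x ^ 2 ≤ x ^ 2 := fun x => sq_le_sq.mpr (Real.abs_sin_le_abs)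
  have hx := key (2 * (m + 2 : ℕ) * θ)
  have hy := key (2 * θ)
  have hm' : ((m + 2 : ℕ) : ℝ) ≤ 3 := by exact_mod_cast (by omega : m + 2 ≤ 3)
  have hx' : (2 * (m + 2 : ℕ) * θ) ^ 2 ≤ 36 * θ ^ 2 := by
    calc (2 * (m + 2 : ℕ) * θ) ^ 2 ≤ (2 * 3 * θ) ^ 2 := by gcongr
      _ = _ := by ring
  have e : evenCoeff θ m - 1 = (Real.sin (2 * θ) ^ 2 - Real.sin (2 * (m + 2 : ℕ) * θ) ^ 2) /
      Real.cos (2 * θ) ^ 2 := by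
    rw [evenCoeff, div_sub_one (by linarith), Real.cos_sq' (2 * (m + 2 : ℕ) * θ)]
    congr 1
    rw [Real.cos_sq']
    ring
  rw [e, abs_div, abs_of_pos (a := Real.cos (2 * θ) ^ 2) (by linarith), div_le_iff₀ (by linarith),
    abs_le]
  constructor <;> nlinarith [sq_nonneg (Real.sin (2 * (m + 2 : ℕ) * θ)), sq_nonneg (Real.sin (2 * θ)),
    sq_nonneg θ]

theorem abs_exp_leadingLog_sub_le {θ : ℝ} (h0 : 0 < θ) (h1 : θ ≤ 1 / 4) :
    |Real.exp (leadingLog θ) - θ ^ 2| ≤ 10 * θ ^ 4 := by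
  have hc := half_le_cos_sq h0 h1
  have hs := sin_pos_of_small h0 h1
  have hs2 : Real.sin θ ≤ θ := Real.sin_le h0.le
  have hs3 : θ - θ ^ 3 / 4 < Real.sin θ := by
    linarith [Real.sin_gt_sub_cube h0, pow_pos h0 3]
  have hy : Real.sin (2 * θ) ^ 2 ≤ (2 * θ) ^ 2 := sq_le_sq.mpr (Real.abs_sin_le_abs)
  have hc' : Real.cos (2 * θ) ^ 2 = 1 - Real.sin (2 * θ) ^ 2 := Real.cos_sq' _
  rw [exp_leadingLog h0 h1, div_sub' (by linarith), abs_div,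
    abs_of_pos (a := Real.cos (2 * θ) ^ 2) (by linarith), div_le_iff₀ (by linarith)]
  have h4 : |Real.sin θ ^ 2 - Real.cos (2 * θ) ^ 2 * θ ^ 2| ≤ 5 * θ ^ 4 := by
    have e3 : θ ^ 3 = θ * θ ^ 2 := by ring
    have h5 : θ ^ 2 - θ ^ 4 / 2 ≤ Real.sin θ ^ 2 := by
      have : 0 ≤ θ - θ ^ 3 / 4 := by nlinarith
      have := pow_le_pow_left₀ this hs3.le 2
      have h6 : 0 ≤ θ ^ 6 := by positivity
      nlinarith
    have h7 : Real.sin θ ^ 2 ≤ θ ^ 2 := by gcongr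
    have h8 : 0 ≤ Real.sin (2 * θ) ^ 2 * θ ^ 2 := by positivity
    have h9 : Real.sin (2 * θ) ^ 2 * θ ^ 2 ≤ (2 * θ) ^ 2 * θ ^ 2 := by gcongr
    have h10 : (2 * θ) ^ 2 * θ ^ 2 = 4 * θ ^ 4 := by ring
    have h11 : 0 ≤ θ ^ 4 := by positivity
    rw [hc', abs_le]
    constructor <;> nlinarith
  nlinarith [show 0 ≤ θ ^ 4 by positivity]

section

-- Angle, zero and branch number all vary along an arbitrary filter; this lets the estimates below
-- apply uniformly in `k`.
variable {ι : Type*} {l : Filter ι} {θ : ι → ℝ} {v : ι → ℂ} {k : ι → ℤ}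

theorem eventually_small (hθ : Tendsto θ l (𝓝[>] 0)) :
    ∀ᶠ i in l, 0 < θ i ∧ θ i ≤ 1 / 4 :=
  (hθ.eventually (Ioo_mem_nhdsGT (show (0 : ℝ) < 1 / 4 by norm_num))).mono
    fun _ h => ⟨h.1, h.2.le⟩

theorem isBigO_of_eventually_le {E : Type*} [Norm E] {f : ι → E} {n : ℕ} (C : ℝ)
    (hθ : Tendsto θ l (𝓝[>] 0)) (h : ∀ᶠ i in l, ‖f i‖ ≤ C * θ i ^ n) :
    f =O[l] fun i => θ i ^ n := by
  refine IsBigO.of_bound C ?_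
  filter_upwards [h, eventually_small hθ] with i hi h0
  rw [Real.norm_of_nonneg (pow_nonneg h0.1.le _)]
  exact hi

variable (hθ : Tendsto θ l (𝓝[>] 0)) (hv : ∀ᶠ i in l, IsBranchZero (θ i) (k i) (v i))

include hθ

theorem isBigO_pow_of_le {m n : ℕ} (h : n ≤ m) : (fun i => θ i ^ m) =O[l] fun i => θ i ^ n := by
  refine isBigO_of_eventually_le 1 hθ ?_
  filter_upwards [eventually_small hθ] with i hi
  rw [Real.norm_of_nonneg (pow_nonneg hi.1.le _), one_mul]
  exact pow_le_pow_of_le_one hi.1.le (by linarith [hi.2]) h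

include hv

theorem isBigO_two_cpow : (fun i => (2 : ℂ) ^ v i) =O[l] fun i => θ i ^ 2 := by
  refine isBigO_of_eventually_le 6 hθ ?_
  filter_upwards [eventually_small hθ, hv] with i h0 h
  exact h.norm_two_cpow_le h0.1 h0.2

theorem isBigO_three_cpow : (fun i => (3 : ℂ) ^ v i) =O[l] fun i => θ i ^ 2 := by
  refine isBigO_of_eventually_le 6 hθ ?_
  filter_upwards [eventually_small hθ, hv] with i h0 h
  exact h.norm_three_cpow_le h0.1 h0.2

theorem isBigO_oddSeries_sub :
    (fun i => tailSeries (oddCoeff (θ i)) (v i) - 9 * 3 ^ v i) =O[l] fun i => θ i ^ 4 := by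
  have h1 : (fun i => tailSeries (oddCoeff (θ i)) (v i) - (oddCoeff (θ i) 0 * 2 ^ v i +
      oddCoeff (θ i) 1 * 3 ^ v i)) =O[l] fun i => θ i ^ 4 := by
    refine isBigO_of_eventually_le (2 * (4 ^ 10 * 36)) hθ ?_
    filter_upwards [eventually_small hθ, hv] with i h0 h
    have := norm_tailSeries_sub_two_terms_le (abs_oddCoeff_le h0.1 h0.2) h.1
    linarith [h.four_rpow_le h0.1 h0.2]
  have h2 : (fun i => ((oddCoeff (θ i) 1 - 9 : ℝ) : ℂ)) =O[l] fun i => θ i ^ 2 := by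
    refine isBigO_of_eventually_le 24 hθ ?_
    filter_upwards [eventually_small hθ] with i h0
    rw [Complex.norm_real]
    exact (abs_oddCoeff_one_sub_le h0.1 h0.2).2
  have h3 := (h2.mul (isBigO_three_cpow hθ hv)).congr_right (g₂ := fun i => θ i ^ 4)
    fun i => by ring
  refine (h1.add h3).congr' ?_ EventuallyEq.rfl
  filter_upwards [eventually_small hθ] with i h0
  rw [(abs_oddCoeff_one_sub_le h0.1 h0.2).1]
  push_cast
  ring

theorem isBigO_evenSeries_sub :
    (fun i => tailSeries (evenCoeff (θ i)) (v i) - (2 ^ v i + 3 ^ v i)) =O[l]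
      fun i => θ i ^ 4 := by
  have h1 : (fun i => tailSeries (evenCoeff (θ i)) (v i) - (evenCoeff (θ i) 0 * 2 ^ v i +
      evenCoeff (θ i) 1 * 3 ^ v i)) =O[l] fun i => θ i ^ 4 := by
    refine isBigO_of_eventually_le (2 * (4 ^ 10 * 36)) hθ ?_
    filter_upwards [eventually_small hθ, hv] with i h0 h
    have := norm_tailSeries_sub_two_terms_le (abs_evenCoeff_le h0.1 h0.2) h.1
    linarith [h.four_rpow_le h0.1 h0.2]
  have h2 : ∀ m ≤ 1, (fun i => ((evenCoeff (θ i) m - 1 : ℝ) : ℂ)) =O[l] fun i => θ i ^ 2 := by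
    intro m hm
    refine isBigO_of_eventually_le 80 hθ ?_
    filter_upwards [eventually_small hθ] with i h0
    rw [Complex.norm_real]
    exact abs_evenCoeff_sub_le h0.1 h0.2 m hm
  have h3 := ((h2 0 zero_le_one).mul (isBigO_two_cpow hθ hv)).congr_right
    (g₂ := fun i => θ i ^ 4) fun i => by ring
  have h4 := ((h2 1 le_rfl).mul (isBigO_three_cpow hθ hv)).congr_right
    (g₂ := fun i => θ i ^ 4) fun i => by ring
  refine ((h1.add h3).add h4).congr_left fun i => ?_
  push_cast
  ring

theorem isBigO_oddSeries :
    (fun i => tailSeries (oddCoeff (θ i)) (v i)) =O[l] fun i => θ i ^ 2 := by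
  have h := ((isBigO_oddSeries_sub hθ hv).trans (isBigO_pow_of_le hθ (show 2 ≤ 4 by norm_num))).add
    ((isBigO_three_cpow hθ hv).const_mul_left 9)
  exact h.congr_left fun i => by ring

theorem isBigO_evenSeries :
    (fun i => tailSeries (evenCoeff (θ i)) (v i)) =O[l] fun i => θ i ^ 2 := by
  have h := ((isBigO_evenSeries_sub hθ hv).trans (isBigO_pow_of_le hθ (show 2 ≤ 4 by norm_num))).add
    ((isBigO_two_cpow hθ hv).add (isBigO_three_cpow hθ hv))
  exact h.congr_left fun i => by ring

omit hv in
theorem isBigO_log_one_add_sub {z : ι → ℂ} (hz : z =O[l] fun i => θ i ^ 2) :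
    (fun i => Complex.log (1 + z i) - z i) =O[l] fun i => θ i ^ 4 := by
  have ht : Tendsto z l (𝓝 0) := hz.trans_tendsto (by
    simpa using (hθ.mono_right nhdsWithin_le_nhds).pow 2)
  have h := (Complex.log_sub_self_isBigO.comp_tendsto ht).trans (hz.pow 2)
  exact h.congr_right fun i => by ring

/-- To first order `A` is `9 · 3 ^ v` and `B` is `2 ^ v + 3 ^ v`; the quadratic terms of the
logarithms and all terms from `4 ^ v` on are `O(θ⁴)`. -/
theorem isBigO_perturbation_sub :
    (fun i => perturbation (θ i) (v i) - (8 * 3 ^ v i - 2 ^ v i)) =O[l] fun i => θ i ^ 4 := by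
  have h1 := isBigO_log_one_add_sub hθ (isBigO_oddSeries hθ hv)
  have h2 := isBigO_log_one_add_sub hθ (isBigO_evenSeries hθ hv)
  refine (((h1.sub h2).add (isBigO_oddSeries_sub hθ hv)).sub
    (isBigO_evenSeries_sub hθ hv)).congr_left fun i => ?_
  rw [perturbation]
  ring

theorem isBigO_perturbation :
    (fun i => perturbation (θ i) (v i)) =O[l] fun i => θ i ^ 2 := by
  have h := ((isBigO_perturbation_sub hθ hv).trans
    (isBigO_pow_of_le hθ (show 2 ≤ 4 by norm_num))).add
    (((isBigO_three_cpow hθ hv).const_mul_left 8).sub (isBigO_two_cpow hθ hv))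
  exact h.congr_left fun i => by ring

omit hv in
theorem isBigO_exp_sub_one {z : ι → ℂ} (hz : z =O[l] fun i => θ i ^ 2) :
    (fun i => Complex.exp (z i) - 1) =O[l] fun i => θ i ^ 2 := by
  have ht : Tendsto z l (𝓝 0) := hz.trans_tendsto (by
    simpa using (hθ.mono_right nhdsWithin_le_nhds).pow 2)
  refine IsBigO.trans (IsBigO.of_bound 2 ?_) hz
  filter_upwards [ht.norm.eventually (ge_mem_nhds (by simp : ‖(0 : ℂ)‖ < 1))] with i hi
  exact Complex.norm_exp_sub_one_le hi

/-- Exponentiating the branch equation gives `2 ^ v = -exp L · exp P`, with `exp L = θ² + O(θ⁴)` and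
`exp P = 1 + O(θ²)`. -/
theorem isBigO_two_cpow_add :
    (fun i => (2 : ℂ) ^ v i + (θ i : ℂ) ^ 2) =O[l] fun i => θ i ^ 4 := by
  have h1 : (fun i => ((Real.exp (leadingLog (θ i)) - θ i ^ 2 : ℝ) : ℂ)) =O[l]
      fun i => θ i ^ 4 := by
    refine isBigO_of_eventually_le 10 hθ ?_
    filter_upwards [eventually_small hθ] with i h0
    rw [Complex.norm_real]
    exact abs_exp_leadingLog_sub_le h0.1 h0.2
  have h2 := isBigO_exp_sub_one hθ (isBigO_perturbation hθ hv)
  have h3 : (fun i => ((Real.exp (leadingLog (θ i)) : ℝ) : ℂ)) =O[l] fun i => θ i ^ 2 := by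
    have h4 : (fun i => ((θ i : ℝ) : ℂ) ^ 2) =O[l] fun i => θ i ^ 2 :=
      isBigO_of_eventually_le 1 hθ (by
        filter_upwards [eventually_small hθ] with i h0
        rw [norm_pow, Complex.norm_real, Real.norm_of_nonneg h0.1.le, one_mul])
    refine ((h1.trans (isBigO_pow_of_le hθ (show 2 ≤ 4 by norm_num))).add h4).congr_left
      fun i => ?_
    push_cast
    ring
  have h5 := (h3.mul h2).congr_right (g₂ := fun i => θ i ^ 4) fun i => by ring
  refine (h1.add h5).neg_left.congr' ?_ EventuallyEq.rfl
  filter_upwards [hv] with i hi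
  have e : (2 : ℂ) ^ v i = -(Complex.exp (leadingLog (θ i)) *
      Complex.exp (perturbation (θ i) (v i))) := by
    rw [Complex.cpow_def_of_ne_zero two_ne_zero, mul_comm, ← Complex.ofReal_ofNat,
      ← Complex.ofReal_log zero_le_two, hi.2, Complex.exp_add, Complex.exp_add,
      show (2 * (k i : ℂ) + 1) * Real.pi * Complex.I =
        Real.pi * Complex.I + k i * (2 * Real.pi * Complex.I) by ring,
      Complex.exp_add, Complex.exp_pi_mul_I, Complex.exp_int_mul_two_pi_mul_I]
    ring
  rw [e]
  push_cast
  ring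

/-- The phase factor of `3 ^ v` on the branch `k`. -/
noncomputable def branchPhase (k : ℤ) : ℂ :=
  Complex.exp ((logRatio * ((2 * (k : ℝ) + 1) * Real.pi) : ℝ) * Complex.I)

omit hθ hv in
theorem norm_branchPhase (k : ℤ) : ‖branchPhase k‖ = 1 := Complex.norm_exp_ofReal_mul_I _

/-- Multiplying the branch equation by `log 3 / log 2` and exponentiating isolates the modulus and
the phase. The relative error `O(θ²)` becomes `O(θ⁴)` because `logRatio > 1`. -/
theorem isBigO_three_cpow_sub :
    (fun i => (3 : ℂ) ^ v i - (θ i ^ (2 * logRatio) : ℝ) * branchPhase (k i)) =O[l]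
      fun i => θ i ^ 4 := by
  have hL : (fun i => ((leadingLog (θ i) - 2 * Real.log (θ i) : ℝ) : ℂ)) =O[l]
      fun i => θ i ^ 2 := by
    refine isBigO_of_eventually_le 15 hθ ?_
    filter_upwards [eventually_small hθ] with i h0
    have h := abs_le.mp (abs_leadingLog_sub_le h0.1 h0.2)
    have h2 : θ i ^ 2 ≤ 1 / 16 := by nlinarith
    have h4 : θ i ^ 4 ≤ 1 / 16 * θ i ^ 2 := by nlinarith [sq_nonneg (θ i)]
    rw [Complex.norm_real, Real.norm_eq_abs, abs_le]
    constructor <;> nlinarith [sq_nonneg (θ i)]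
  have h1 := isBigO_exp_sub_one hθ ((hL.add (isBigO_perturbation hθ hv)).const_mul_left logRatio)
  have h2 : (fun i => ((θ i ^ (2 * logRatio) : ℝ) : ℂ) * branchPhase (k i)) =O[l]
      fun i => θ i ^ 2 := by
    refine isBigO_of_eventually_le 1 hθ ?_
    filter_upwards [eventually_small hθ] with i h0
    rw [norm_mul, norm_branchPhase, mul_one, one_mul, Complex.norm_real,
      Real.norm_of_nonneg (Real.rpow_nonneg h0.1.le _), ← Real.rpow_natCast]
    refine Real.rpow_le_rpow_of_exponent_ge h0.1 (by linarith [h0.2]) ?_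
    push_cast
    linarith [one_lt_logRatio]
  refine (h2.mul h1).congr' ?_ (Eventually.of_forall fun i => by ring)
  filter_upwards [eventually_small hθ, hv] with i h0 hi
  have hl2 : ((Real.log 2 : ℝ) : ℂ) ≠ 0 := by exact_mod_cast (Real.log_pos one_lt_two).ne'
  have e : (3 : ℂ) ^ v i = (θ i ^ (2 * logRatio) : ℝ) * branchPhase (k i) *
      Complex.exp (logRatio * (((leadingLog (θ i) - 2 * Real.log (θ i) : ℝ) : ℂ) +
        perturbation (θ i) (v i))) := by
    rw [Complex.cpow_def_of_ne_zero three_ne_zero, ← Complex.ofReal_ofNat,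
      ← Complex.ofReal_log zero_le_three, Real.rpow_def_of_pos h0.1, branchPhase,
      Complex.ofReal_exp, ← Complex.exp_add, ← Complex.exp_add]
    congr 1
    have e3 : ((Real.log 3 : ℝ) : ℂ) = logRatio * (Real.log 2 : ℝ) := by
      rw [logRatio]; push_cast; field_simp
    rw [e3, mul_assoc, mul_comm ((Real.log 2 : ℝ) : ℂ), hi.2]
    push_cast
    ring
  rw [e]
  ring

/-- The expansion of the zeros in terms of the angle `θ`. -/
theorem isBigO_branchZero_sub :
    (fun i => v i * Real.log 2 - ((leadingLog (θ i) + θ i ^ 2 : ℝ) +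
      (2 * k i + 1) * Real.pi * Complex.I +
      8 * ((θ i ^ (2 * logRatio) : ℝ) * branchPhase (k i)))) =O[l] fun i => θ i ^ 4 := by
  refine (((isBigO_perturbation_sub hθ hv).add
    ((isBigO_three_cpow_sub hθ hv).const_mul_left 8)).sub
    (isBigO_two_cpow_add hθ hv)).congr' ?_ EventuallyEq.rfl
  filter_upwards [hv] with i hi
  rw [hi.2]
  push_cast
  ring

end

/-! ### Comparison with `ζ` to the right of `re s = -3/4` -/

section

open HurwitzZeta

/-- Splitting `ζ` into odd and even integers gives `2 ^ s ζ(s) = ζ(s, 1/2) + ζ(s)`; this is what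
makes the energy of the unperturbed lattice equal to `ζ`. -/
theorem hurwitzZetaEven_half_of_one_lt_re {s : ℂ} (hs : 1 < s.re) :
    riemannZeta s + hurwitzZetaEven ((1 / 2 : ℝ) : UnitAddCircle) s = 2 ^ s * riemannZeta s := by
  have h2 : (2 : ℂ) ^ s ≠ 0 := by simp [Complex.cpow_eq_zero_iff]
  have hv : (-s).re < -1 := by simp; linarith
  have e : ∀ n : ℕ, 1 / ((n : ℂ) + 1) ^ s = 1 * ((n + 1 : ℕ) : ℂ) ^ (-s) := fun n => by
    rw [Complex.cpow_neg]; simp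
  have hz : HasSum (fun n : ℕ => 1 / ((n : ℂ) + 1) ^ s) (riemannZeta s) := by
    rw [zeta_eq_tsum_one_div_nat_add_one_cpow hs]
    simp_rw [e]
    exact (summable_mul_natSucc_cpow (c := fun _ => 1) (by simp) hv).hasSum
  have hh := hasSum_nat_hurwitzZetaEven_of_mem_Icc (a := 1 / 2) (by norm_num) hs
  have h1 : HasSum (fun n : ℕ => 1 / ((n : ℂ) + 1) ^ s)
      (1 / 2 ^ s * hurwitzZetaEven ((1 / 2 : ℝ) : UnitAddCircle) s + 1 / 2 ^ s * riemannZeta s) := by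
    refine HasSum.even_add_odd (f := fun n : ℕ => 1 / ((n : ℂ) + 1) ^ s) ?_ ?_
    · refine (hh.mul_left (1 / 2 ^ s)).congr_fun fun n => ?_
      have h3 : (((2 * n : ℕ) : ℂ) + 1) ^ s = 2 ^ s * ((n : ℂ) + ((1 / 2 : ℝ) : ℂ)) ^ s := by
        have := Complex.mul_cpow_ofReal_nonneg (a := 2) (b := n + 1 / 2) (by norm_num)
          (by positivity) s
        push_cast at this ⊢
        rw [← this]
        congr 1
        ring
      have h4 : (n : ℂ) + 1 - ((1 / 2 : ℝ) : ℂ) = (n : ℂ) + ((1 / 2 : ℝ) : ℂ) := by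
        push_cast; ring
      rw [h3, h4]
      ring
    · refine (hz.mul_left (1 / 2 ^ s)).congr_fun fun n => ?_
      have h3 : (((2 * n + 1 : ℕ) : ℂ) + 1) ^ s = 2 ^ s * ((n : ℂ) + 1) ^ s := by
        have := Complex.mul_cpow_ofReal_nonneg (a := 2) (b := n + 1) (by norm_num)
          (by positivity) s
        push_cast at this ⊢
        rw [← this]
        congr 1
        ring
      rw [h3]
      ring
  have h5 := hz.unique h1
  field_simp at h5
  linear_combination -h5

theorem hurwitzZetaEven_half {s : ℂ} (hs : s ≠ 1) :
    riemannZeta s + hurwitzZetaEven ((1 / 2 : ℝ) : UnitAddCircle) s = 2 ^ s * riemannZeta s := by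
  have hopen : IsOpen ({1}ᶜ : Set ℂ) := isOpen_compl_singleton
  have hf : AnalyticOnNhd ℂ (fun s => riemannZeta s +
      hurwitzZetaEven ((1 / 2 : ℝ) : UnitAddCircle) s) {1}ᶜ :=
    DifferentiableOn.analyticOnNhd (fun z hz => ((differentiableAt_riemannZeta hz).add
      (differentiableAt_hurwitzZetaEven _ hz)).differentiableWithinAt) hopen
  have hg : AnalyticOnNhd ℂ (fun s => (2 : ℂ) ^ s * riemannZeta s) {1}ᶜ :=
    DifferentiableOn.analyticOnNhd (fun z hz => (((differentiableAt_id.const_cpow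
      (Or.inl two_ne_zero))).mul (differentiableAt_riemannZeta hz)).differentiableWithinAt) hopen
  refine hf.eqOn_of_preconnected_of_eventuallyEq hg
    (isConnected_compl_singleton_of_one_lt_rank (by simp) _).isPreconnected (z₀ := 2)
    (by norm_num) ?_ hs
  filter_upwards [(isOpen_lt continuous_const Complex.continuous_re).mem_nhds
    (show (1 : ℝ) < (2 : ℂ).re by norm_num)] with z hz
  exact hurwitzZetaEven_half_of_one_lt_re hz

theorem latticeEnergy_sub_riemannZeta {ε : ℝ} (hε : ε < 2) {s : ℂ} (hs : s ≠ 1) :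
    latticeEnergy s (1 - ε) - riemannZeta s = 1 / 2 ^ s *
      (hurwitzZetaEven ((1 / 2 - latticeAngle ε / Real.pi : ℝ) : UnitAddCircle) s -
        hurwitzZetaEven ((1 / 2 : ℝ) : UnitAddCircle) s) := by
  have h2 : (2 : ℂ) ^ s ≠ 0 := by simp [Complex.cpow_eq_zero_iff]
  have h := hurwitzZetaEven_half hs
  rw [latticeEnergy_eq_hurwitzZetaEven (by linarith), offset_eq hε]
  field_simp
  linear_combination h

/-- The symmetric second difference of `t ↦ t ^ (-s)`. -/
noncomputable def secondDiff (c δ : ℝ) (s : ℂ) : ℂ :=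
  ((c - δ : ℝ) : ℂ) ^ (-s) + ((c + δ : ℝ) : ℂ) ^ (-s) - 2 * (c : ℂ) ^ (-s)

theorem hasDerivAt_ofReal_cpow {t : ℝ} (ht : 0 < t) (w : ℂ) :
    HasDerivAt (fun t : ℝ => (t : ℂ) ^ w) (w * (t : ℂ) ^ (w - 1)) t := by
  have h := ((hasDerivAt_id (t : ℂ)).cpow_const (c := w)
    (Complex.ofReal_mem_slitPlane.mpr ht)).comp_ofReal
  simpa using h

/-- Two mean value estimates: the derivative in `δ` is `s` times a difference of values of `t ^ (-s
- 1)`, itself bounded through `t ^ (-s - 2)`. The gain of two powers makes the series over `c = n +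
1/2` converge left of `re s = 0`. -/
theorem norm_secondDiff_le {c δ : ℝ} (hδ : 0 ≤ δ) (hc : δ < c) {s : ℂ} (hs : -2 ≤ s.re) :
    ‖secondDiff c δ s‖ ≤ 2 * δ ^ 2 * (‖s‖ * (‖s‖ + 1)) * (c - δ) ^ (-s.re - 2) := by
  have hcδ : 0 < c - δ := by linarith
  set M := (c - δ) ^ (-s.re - 2) with hM
  have hM0 : 0 ≤ M := by positivity
  have hψ : ∀ x ∈ Set.Icc (c - δ) (c + δ), ∀ y ∈ Set.Icc (c - δ) (c + δ),
      ‖(y : ℂ) ^ (-s - 1) - (x : ℂ) ^ (-s - 1)‖ ≤ (‖s‖ + 1) * M * ‖y - x‖ := by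
    intro x hx y hy
    refine Convex.norm_image_sub_le_of_norm_hasDerivWithin_le
      (f := fun t : ℝ => (t : ℂ) ^ (-s - 1)) (fun t ht =>
        (hasDerivAt_ofReal_cpow (hcδ.trans_le ht.1) (-s - 1)).hasDerivWithinAt)
      (fun t ht => ?_) (convex_Icc _ _) hx hy
    have ht0 := hcδ.trans_le ht.1
    rw [norm_mul, Complex.norm_cpow_eq_rpow_re_of_pos ht0]
    have h1 : ‖-s - 1‖ ≤ ‖s‖ + 1 := by
      refine (norm_sub_le _ _).trans ?_
      rw [norm_neg, norm_one]
    have h2 : t ^ (-s - 1 - 1).re ≤ M := by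
      rw [hM, show (-s - 1 - 1).re = -s.re - 2 by simp; ring]
      exact Real.rpow_le_rpow_of_nonpos hcδ ht.1 (by linarith)
    gcongr
  have hφ : ∀ t ∈ Set.Icc (0 : ℝ) δ, HasDerivWithinAt (fun t : ℝ => secondDiff c t s)
      (s * (((c - t : ℝ) : ℂ) ^ (-s - 1) - ((c + t : ℝ) : ℂ) ^ (-s - 1))) (Set.Icc 0 δ) t := by
    intro t ht
    have d1 := (hasDerivAt_ofReal_cpow (show 0 < c - t by linarith [ht.2]) (-s)).scomp t
      ((hasDerivAt_id t).const_sub c)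
    have d2 := (hasDerivAt_ofReal_cpow (show 0 < c + t by linarith [ht.1]) (-s)).scomp t
      ((hasDerivAt_id t).const_add c)
    have d := ((d1.add d2).sub_const (2 * (c : ℂ) ^ (-s))).hasDerivWithinAt (s := Set.Icc 0 δ)
    refine HasDerivWithinAt.congr_deriv d ?_
    simp
    ring
  have h0 : secondDiff c 0 s = 0 := by simp [secondDiff]; ring
  have hmain := Convex.norm_image_sub_le_of_norm_hasDerivWithin_le
    (C := ‖s‖ * ((‖s‖ + 1) * M * (2 * δ))) hφ (fun t ht => ?_) (convex_Icc _ _)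
    (Set.left_mem_Icc.mpr hδ) (Set.right_mem_Icc.mpr hδ)
  · rw [h0, sub_zero, sub_zero, Real.norm_of_nonneg hδ] at hmain
    refine hmain.trans (le_of_eq ?_)
    ring
  · rw [norm_mul]
    refine mul_le_mul_of_nonneg_left ?_ (norm_nonneg _)
    refine (hψ (c + t) ⟨by linarith [ht.1], by linarith [ht.2]⟩ (c - t)
      ⟨by linarith [ht.2], by linarith [ht.1]⟩).trans ?_
    refine mul_le_mul_of_nonneg_left ?_ (by positivity)
    rw [show c - t - (c + t) = -(2 * t) by ring, norm_neg, Real.norm_of_nonneg (by linarith [ht.1])]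
    linarith [ht.2]

theorem norm_secondDiff_natCast_le {δ : ℝ} (h0 : 0 ≤ δ) (h1 : δ ≤ 1 / 4) {R : ℝ} {s : ℂ}
    (hs : -(3 / 4) < s.re) (hR : ‖s‖ < R) (n : ℕ) :
    ‖secondDiff (n + 1 / 2) δ s / 2‖ ≤
      δ ^ 2 * (R * (R + 1) * 4 ^ (R + 2)) * ((n + 1 : ℕ) : ℝ) ^ (-(5 / 4) : ℝ) := by
  have hn : (0 : ℝ) ≤ n := n.cast_nonneg
  have hx := (Complex.abs_re_le_norm s).trans hR.le
  have hx' := (abs_le.mp hx).2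
  have h2 : ((n : ℝ) + 1 / 2 - δ) ^ (-s.re - 2) ≤
      4 ^ (R + 2) * ((n + 1 : ℕ) : ℝ) ^ (-(5 / 4) : ℝ) := by
    calc ((n : ℝ) + 1 / 2 - δ) ^ (-s.re - 2) ≤ (((n + 1 : ℕ) : ℝ) / 4) ^ (-s.re - 2) := by
          refine Real.rpow_le_rpow_of_nonpos (by positivity) ?_ (by linarith)
          push_cast
          linarith
      _ = 4 ^ (s.re + 2) * ((n + 1 : ℕ) : ℝ) ^ (-s.re - 2) := by
          rw [Real.div_rpow (by positivity) (by norm_num), show s.re + 2 = -(-s.re - 2) by ring,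
            Real.rpow_neg (by norm_num)]
          field_simp
      _ ≤ _ := by
          have h3 : (1 : ℝ) ≤ ((n + 1 : ℕ) : ℝ) := by push_cast; linarith
          have h4 := Real.rpow_le_rpow_of_exponent_le h3
            (show -s.re - 2 ≤ -(5 / 4) by linarith)
          have h5 := Real.rpow_le_rpow_of_exponent_le (show (1 : ℝ) ≤ 4 by norm_num)
            (show s.re + 2 ≤ R + 2 by linarith)
          gcongr
  have h3 := norm_secondDiff_le (c := n + 1 / 2) h0 (by linarith) (show -2 ≤ s.re by linarith)
  have hs0 := norm_nonneg s
  rw [norm_div, Complex.norm_ofNat]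
  calc _ ≤ (2 * δ ^ 2 * (‖s‖ * (‖s‖ + 1)) * ((n : ℝ) + 1 / 2 - δ) ^ (-s.re - 2)) / 2 := by gcongr
    _ ≤ (2 * δ ^ 2 * (R * (R + 1)) * (4 ^ (R + 2) * ((n + 1 : ℕ) : ℝ) ^ (-(5 / 4) : ℝ))) / 2 := by
      have : 0 ≤ ((n : ℝ) + 1 / 2 - δ) ^ (-s.re - 2) := Real.rpow_nonneg (by linarith) _
      have hR0 : 0 ≤ R := by linarith
      gcongr
    _ = _ := by ring

theorem hurwitzZetaEven_sub_of_one_lt_re {δ : ℝ} (h0 : 0 ≤ δ) (h1 : δ ≤ 1 / 4) {s : ℂ}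
    (hs : 1 < s.re) : hurwitzZetaEven ((1 / 2 - δ : ℝ) : UnitAddCircle) s -
      hurwitzZetaEven ((1 / 2 : ℝ) : UnitAddCircle) s =
      ∑' n : ℕ, secondDiff (n + 1 / 2) δ s / 2 := by
  have e1 := hasSum_nat_hurwitzZetaEven_of_mem_Icc (a := 1 / 2 - δ)
    ⟨by linarith, by linarith⟩ hs
  have e2 := hasSum_nat_hurwitzZetaEven_of_mem_Icc (a := 1 / 2) (by norm_num) hs
  refine (e1.sub e2).tsum_eq.symm.trans (tsum_congr fun n => ?_)
  rw [secondDiff, Complex.cpow_neg, Complex.cpow_neg, Complex.cpow_neg]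
  rw [show (n : ℂ) + ((1 / 2 - δ : ℝ) : ℂ) = ((n + 1 / 2 - δ : ℝ) : ℂ) by push_cast; ring,
    show (n : ℂ) + 1 - ((1 / 2 - δ : ℝ) : ℂ) = ((n + 1 / 2 + δ : ℝ) : ℂ) by push_cast; ring,
    show (n : ℂ) + ((1 / 2 : ℝ) : ℂ) = ((n + 1 / 2 : ℝ) : ℂ) by push_cast; ring,
    show (n : ℂ) + 1 - ((1 / 2 : ℝ) : ℂ) = ((n + 1 / 2 : ℝ) : ℂ) by push_cast; ring]
  ring

/-- The poles at `1` cancel in the difference, so the series identity valid for `re s > 1` continues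
to the whole truncated half-plane by the identity theorem. -/
theorem norm_hurwitzZetaEven_sub_le {δ : ℝ} (h0 : 0 ≤ δ) (h1 : δ ≤ 1 / 4) {R : ℝ} (hR2 : 2 < R)
    {s : ℂ} (hs : -(3 / 4) < s.re) (hR : ‖s‖ < R) :
    ‖hurwitzZetaEven ((1 / 2 - δ : ℝ) : UnitAddCircle) s -
      hurwitzZetaEven ((1 / 2 : ℝ) : UnitAddCircle) s‖ ≤
      δ ^ 2 * (R * (R + 1) * 4 ^ (R + 2)) * ∑' n : ℕ, ((n + 1 : ℕ) : ℝ) ^ (-(5 / 4) : ℝ) := by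
  have hsum := (summable_natSucc_rpow (show (-(5 / 4) : ℝ) < -1 by norm_num)).mul_left
    (δ ^ 2 * (R * (R + 1) * 4 ^ (R + 2)))
  set U : Set ℂ := {s : ℂ | -(3 / 4) < s.re} ∩ Metric.ball 0 R
  have hUo : IsOpen U := (isOpen_lt continuous_const Complex.continuous_re).inter Metric.isOpen_ball
  have hUc : IsPreconnected U :=
    ((convex_halfSpace_re_gt _).inter (convex_ball _ _)).isPreconnected
  have hbound : ∀ (n : ℕ), ∀ z ∈ U, ‖secondDiff (n + 1 / 2) δ z / 2‖ ≤
      δ ^ 2 * (R * (R + 1) * 4 ^ (R + 2)) * ((n + 1 : ℕ) : ℝ) ^ (-(5 / 4) : ℝ) := fun n z hz =>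
    norm_secondDiff_natCast_le h0 h1 hz.1 (mem_ball_zero_iff.mp hz.2) n
  have hd : DifferentiableOn ℂ (fun z => ∑' n : ℕ, secondDiff (n + 1 / 2) δ z / 2) U := by
    refine Complex.differentiableOn_tsum_of_summable_norm hsum (fun n => ?_) hUo hbound
    have hne : ∀ t : ℝ, 0 < t → Differentiable ℂ fun z : ℂ => (t : ℂ) ^ (-z) := fun t ht =>
      differentiable_neg.const_cpow (Or.inl (by exact_mod_cast ht.ne'))
    have hn : (0 : ℝ) ≤ n := n.cast_nonneg
    have := (((hne (n + 1 / 2 - δ) (by linarith)).add (hne (n + 1 / 2 + δ) (by linarith))).sub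
      ((hne (n + 1 / 2) (by linarith)).const_mul 2)).div_const 2
    exact this.differentiableOn
  have heq : Set.EqOn (fun z => hurwitzZetaEven ((1 / 2 - δ : ℝ) : UnitAddCircle) z -
      hurwitzZetaEven ((1 / 2 : ℝ) : UnitAddCircle) z)
      (fun z => ∑' n : ℕ, secondDiff (n + 1 / 2) δ z / 2) U := by
    refine ((differentiable_hurwitzZetaEven_sub_hurwitzZetaEven _ _).differentiableOn.analyticOnNhd
      hUo).eqOn_of_preconnected_of_eventuallyEq (hd.analyticOnNhd hUo) hUc (z₀ := 2)
      ⟨by norm_num, by simpa using hR2⟩ ?_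
    filter_upwards [(isOpen_lt continuous_const Complex.continuous_re).mem_nhds
      (show (1 : ℝ) < (2 : ℂ).re by norm_num)] with z hz
    exact hurwitzZetaEven_sub_of_one_lt_re h0 h1 hz
  have hsU : s ∈ U := ⟨hs, mem_ball_zero_iff.mpr hR⟩
  rw [show hurwitzZetaEven ((1 / 2 - δ : ℝ) : UnitAddCircle) s -
    hurwitzZetaEven ((1 / 2 : ℝ) : UnitAddCircle) s = _ from heq hsU, ← tsum_mul_left]
  exact tsum_of_norm_bounded hsum.hasSum fun n => hbound n s hsU

theorem eventually_norm_latticeEnergy_sub_le (R : ℝ) {η : ℝ} (hη : 0 < η) :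
    ∀ᶠ ε in 𝓝[>] (0 : ℝ), ∀ s : ℂ, s ≠ 1 → -(3 / 4) < s.re → ‖s‖ < R →
      ‖latticeEnergy s (1 - ε) - riemannZeta s‖ ≤ η := by
  set R' := max R 3
  set C := (2 : ℝ) ^ R' * ((R' * (R' + 1) * 4 ^ (R' + 2)) *
    ∑' n : ℕ, ((n + 1 : ℕ) : ℝ) ^ (-(5 / 4) : ℝ))
  have hδ : Tendsto (fun ε => latticeAngle ε / Real.pi) (𝓝[>] 0) (𝓝 0) := by
    simpa using (tendsto_latticeAngle.mono_right nhdsWithin_le_nhds).div_const Real.pi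
  have hC : Tendsto (fun ε => (latticeAngle ε / Real.pi) ^ 2 * C) (𝓝[>] 0) (𝓝 0) := by
    simpa using (hδ.pow 2).mul_const C
  filter_upwards [hC.eventually (ge_mem_nhds hη), Ioo_mem_nhdsGT (zero_lt_one' ℝ),
    hδ.eventually (ge_mem_nhds (show (0 : ℝ) < 1 / 4 by norm_num))] with ε h1 h2 h3 s hs1 hs2 hs3
  have hs4 : ‖s‖ < R' := hs3.trans_le (le_max_left _ _)
  have h0 : 0 ≤ latticeAngle ε / Real.pi :=
    div_nonneg (latticeAngle_le h2.1 h2.2.le).1.le Real.pi_pos.le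
  rw [latticeEnergy_sub_riemannZeta (by linarith [h2.2]) hs1, norm_mul]
  have h5 := norm_hurwitzZetaEven_sub_le h0 h3 (show 2 < R' by
    linarith [le_max_right R 3]) hs2 hs4
  have h6 : ‖1 / (2 : ℂ) ^ s‖ ≤ 2 ^ R' := by
    have e := Complex.norm_natCast_cpow_of_pos (n := 2) two_pos (-s)
    push_cast at e
    rw [one_div, ← Complex.cpow_neg, e]
    refine Real.rpow_le_rpow_of_exponent_le one_le_two ?_
    have := (abs_le.mp ((Complex.abs_re_le_norm s).trans hs4.le)).1
    simp
    linarith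
  calc _ ≤ _ := mul_le_mul h6 h5 (norm_nonneg _) (by positivity)
    _ = (latticeAngle ε / Real.pi) ^ 2 * C := by ring
    _ ≤ η := h1

theorem norm_tsum_le_pi_sq {b : ℕ → ℂ} {S : ℂ} (h : HasSum b S)
    (hb : ∀ n : ℕ, ‖b n‖ ≤ 1 / ((n + 1 : ℕ) : ℝ) ^ 2) : ‖S‖ ≤ 2 := by
  -- The removed term is `1 / 0 ^ 2 = 0`, so the sum is still `π² / 6 < 2`.
  have hz := (hasSum_nat_add_iff' 1).mpr hasSum_zeta_two
  rw [← h.tsum_eq]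
  refine (tsum_of_norm_bounded hz hb).trans ?_
  simp
  nlinarith [Real.pi_lt_d2, Real.pi_pos]

theorem norm_one_div_cpow_le {t : ℝ} {n : ℕ} (ht : (n + 1 : ℕ) ≤ t) {s : ℂ} (hs : 2 ≤ s.re) :
    ‖1 / (t : ℂ) ^ s‖ ≤ 1 / ((n + 1 : ℕ) : ℝ) ^ 2 := by
  have hn : (1 : ℝ) ≤ ((n + 1 : ℕ) : ℝ) := by exact_mod_cast Nat.le_add_left 1 n
  have ht0 : 0 < t := by linarith
  rw [norm_div, norm_one, Complex.norm_cpow_eq_rpow_re_of_pos ht0]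
  refine one_div_le_one_div_of_le (by positivity) ?_
  calc ((n + 1 : ℕ) : ℝ) ^ 2 ≤ t ^ 2 := by gcongr
    _ = t ^ (2 : ℝ) := by norm_cast
    _ ≤ _ := Real.rpow_le_rpow_of_exponent_le (by linarith) hs

/-- The nearest-neighbour terms `a ^ (-s) + b ^ (-s)` cannot cancel: the condition on `im s` keeps
`(a / b) ^ s` in the right half-plane. Their half-sum has modulus at least `8`, while `ζ(s)` and the
remaining terms are at most `2` each. -/
theorem latticeEnergy_ne_zero_of_le_re {ε : ℝ} (h0 : 0 < ε) (h1 : ε < 1) {δ : ℝ}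
    (hδ : δ = latticeAngle ε / Real.pi) (hδ2 : δ ≤ 1 / 4) {s : ℂ} (hs : 4 ≤ s.re)
    (him : |s.im * Real.log ((1 / 2 - δ) / (1 / 2 + δ))| ≤ Real.pi / 2) :
    latticeEnergy s (1 - ε) ≠ 0 := by
  have hδ0 : 0 ≤ δ := hδ ▸ div_nonneg (latticeAngle_le h0 h1.le).1.le Real.pi_pos.le
  have h2 : (2 : ℂ) ^ s ≠ 0 := by simp [Complex.cpow_eq_zero_iff]
  set a : ℝ := 1 / 2 - δ with ha
  set b : ℝ := 1 / 2 + δ with hb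
  have ha0 : 0 < a := by linarith
  have hb0 : 0 < b := by linarith
  have hs1 : 1 < s.re := by linarith
  intro hE
  rw [latticeEnergy_eq_hurwitzZetaEven (by linarith), offset_eq (by linarith), ← hδ,
    mul_eq_zero, or_iff_right (by simp), ← ha] at hE
  have hz : ‖riemannZeta s‖ ≤ 2 := by
    have hsum : HasSum (fun n : ℕ => 1 / ((n : ℂ) + 1) ^ s) (riemannZeta s) := by
      rw [zeta_eq_tsum_one_div_nat_add_one_cpow hs1]
      refine Summable.hasSum ?_
      refine Summable.of_norm_bounded ((hasSum_nat_add_iff' 1).mpr hasSum_zeta_two).summable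
        fun n => ?_
      have := norm_one_div_cpow_le (t := (n + 1 : ℕ)) le_rfl (show 2 ≤ s.re by linarith)
      simpa using this
    refine norm_tsum_le_pi_sq hsum fun n => ?_
    have := norm_one_div_cpow_le (t := (n + 1 : ℕ)) le_rfl (show 2 ≤ s.re by linarith)
    simpa using this
  have hH := hasSum_nat_hurwitzZetaEven_of_mem_Icc (a := a) ⟨ha0.le, by linarith⟩ hs1
  rw [← hasSum_nat_add_iff' 1] at hH
  have hrest := norm_tsum_le_pi_sq hH fun n => by
    have hn : (0 : ℝ) ≤ n := n.cast_nonneg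
    have e1 := norm_one_div_cpow_le (n := n) (t := (n + 1 : ℕ) + a) (by linarith)
      (show 2 ≤ s.re by linarith)
    have e2 := norm_one_div_cpow_le (n := n) (t := (n + 1 : ℕ) + 1 - a) (by linarith)
      (show 2 ≤ s.re by linarith)
    rw [norm_div, Complex.norm_ofNat, div_le_iff₀ two_pos]
    refine (norm_add_le _ _).trans ?_
    push_cast at e1 e2 ⊢
    linarith
  simp only [Finset.range_one, Finset.sum_singleton, Nat.cast_zero, zero_add] at hrest
  have hmain : 16 ≤ ‖1 / (a : ℂ) ^ s + 1 / (1 - (a : ℂ)) ^ s‖ := by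
    have hab : 1 - (a : ℂ) = (b : ℂ) := by rw [ha, hb]; push_cast; ring
    have hane : (a : ℂ) ^ s ≠ 0 := by
      rw [Ne, Complex.cpow_eq_zero_iff]; push Not; intro h; exact absurd h (by exact_mod_cast ha0.ne')
    have hq : ((a / b : ℝ) : ℂ) ^ s * (b : ℂ) ^ s = (a : ℂ) ^ s := by
      rw [← Complex.mul_cpow_ofReal_nonneg (by positivity) hb0.le, ← Complex.ofReal_mul,
        div_mul_cancel₀ _ hb0.ne']
    have hbne : (b : ℂ) ^ s ≠ 0 := fun h => hane (by rw [← hq, h, mul_zero])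
    have e : 1 / (a : ℂ) ^ s + 1 / (1 - (a : ℂ)) ^ s =
        1 / (a : ℂ) ^ s * (1 + ((a / b : ℝ) : ℂ) ^ s) := by
      rw [hab]
      field_simp
      linear_combination -hq
    have hre : 0 ≤ (((a / b : ℝ) : ℂ) ^ s).re := by
      have hq0 : 0 < a / b := by positivity
      rw [Complex.cpow_def_of_ne_zero (by exact_mod_cast hq0.ne'), ← Complex.ofReal_log hq0.le,
        Complex.exp_re]
      refine mul_nonneg (Real.exp_pos _).le (Real.cos_nonneg_of_mem_Icc ?_)
      rw [Complex.im_ofReal_mul, mul_comm]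
      exact abs_le.mp him
    have h1' : 1 ≤ ‖1 + ((a / b : ℝ) : ℂ) ^ s‖ := by
      refine le_trans ?_ (Complex.re_le_norm _)
      simp only [Complex.add_re, Complex.one_re]
      linarith
    have h16 : 16 ≤ ‖1 / (a : ℂ) ^ s‖ := by
      rw [norm_div, norm_one, Complex.norm_cpow_eq_rpow_re_of_pos ha0, le_div_iff₀ (by positivity)]
      have : a ^ s.re ≤ (1 / 2) ^ 4 := by
        calc a ^ s.re ≤ a ^ (4 : ℝ) := Real.rpow_le_rpow_of_exponent_ge ha0 (by linarith) hs
          _ = a ^ 4 := by norm_cast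
          _ ≤ _ := by gcongr; linarith
      linarith
    rw [e, norm_mul]
    nlinarith
  have hfin : (1 / (a : ℂ) ^ s + 1 / (1 - (a : ℂ)) ^ s) / 2 =
      -(hurwitzZetaEven (a : UnitAddCircle) s - (1 / (a : ℂ) ^ s + 1 / (1 - (a : ℂ)) ^ s) / 2) -
        riemannZeta s := by
    linear_combination hE
  have h8 : 8 ≤ ‖(1 / (a : ℂ) ^ s + 1 / (1 - (a : ℂ)) ^ s) / 2‖ := by
    rw [norm_div, Complex.norm_ofNat]; linarith
  rw [hfin] at h8
  have h9 := norm_sub_le (-(hurwitzZetaEven (a : UnitAddCircle) s -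
    (1 / (a : ℂ) ^ s + 1 / (1 - (a : ℂ)) ^ s) / 2)) (riemannZeta s)
  rw [norm_neg] at h9
  linarith

theorem eventually_latticeEnergy_ne_zero (T : ℝ) :
    ∀ᶠ ε in 𝓝[>] (0 : ℝ), ∀ s : ℂ, 4 ≤ s.re → |s.im| ≤ T → latticeEnergy s (1 - ε) ≠ 0 := by
  have hδ : Tendsto (fun ε => latticeAngle ε / Real.pi) (𝓝[>] 0) (𝓝 0) := by
    simpa using (tendsto_latticeAngle.mono_right nhdsWithin_le_nhds).div_const Real.pi
  have hcont : ContinuousAt (fun δ : ℝ => T * |Real.log ((1 / 2 - δ) / (1 / 2 + δ))|) 0 := by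
    refine continuousAt_const.mul (ContinuousAt.abs (ContinuousAt.log ?_ (by norm_num)))
    exact ContinuousAt.div (by fun_prop) (by fun_prop) (by norm_num)
  have hlim := hcont.tendsto.comp hδ
  norm_num at hlim
  filter_upwards [hlim.eventually (ge_mem_nhds (show (0 : ℝ) < Real.pi / 2 by positivity)),
    Ioo_mem_nhdsGT (zero_lt_one' ℝ),
    hδ.eventually (ge_mem_nhds (show (0 : ℝ) < 1 / 4 by norm_num))] with ε h1 h2 h3 s hs him
  refine latticeEnergy_ne_zero_of_le_re h2.1 h2.2 rfl h3 hs ?_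
  rw [abs_mul]
  refine le_trans (mul_le_mul_of_nonneg_right him (abs_nonneg _)) ?_
  simpa using h1

end

/-! ### The branch zeros as zeros of the energy -/

/-- The off-critical zeros of the lattice energy. -/
noncomputable def branchZero (ε : ℝ) (k : ℤ) : ℂ :=
  1 + Classical.epsilon (IsBranchZero (latticeAngle ε) k)

theorem tendsto_leadingLog : Tendsto leadingLog (𝓝[>] 0) atBot := by
  have h : Tendsto (fun θ : ℝ => 2 * Real.log θ + 1) (𝓝[>] 0) atBot :=
    tendsto_atBot_add_const_right _ _ (Real.tendsto_log_nhdsGT_zero.const_mul_atBot two_pos)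
  refine tendsto_atBot_mono' _ ?_ h
  filter_upwards [Ioo_mem_nhdsGT (show (0 : ℝ) < 1 / 4 by norm_num)] with θ hθ
  have h1 := (abs_le.mp (abs_leadingLog_sub_le hθ.1 hθ.2.le)).2
  have h2 : θ ^ 2 ≤ 1 / 16 := by nlinarith [hθ.1, hθ.2]
  have h4 : θ ^ 4 ≤ 1 / 16 * (1 / 16) := by
    calc θ ^ 4 = θ ^ 2 * θ ^ 2 := by ring
      _ ≤ _ := by gcongr
  linarith

theorem eventually_existsUnique_isBranchZero :
    ∀ᶠ ε in 𝓝[>] (0 : ℝ), 0 < ε ∧ ε < 1 ∧ 0 < latticeAngle ε ∧ latticeAngle ε ≤ 1 / 4 ∧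
      ∀ k : ℤ, ∃! v : ℂ, IsBranchZero (latticeAngle ε) k v := by
  filter_upwards [eventually_small tendsto_latticeAngle, Ioo_mem_nhdsGT (zero_lt_one' ℝ),
    (tendsto_leadingLog.comp tendsto_latticeAngle).eventually (eventually_le_atBot (-8))]
    with ε h hε hL
  refine ⟨hε.1, hε.2, h.1, h.2, fun k => ?_⟩
  refine existsUnique_fixedPoint (fun v hv => norm_perturbation_le h.1 h.2 hv)
    (fun v w hv hw => norm_perturbation_sub_le h.1 h.2 hv hw) ?_
  -- The branch term is purely imaginary, so one smallness condition on `ε` serves all `k`.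
  have e : (leadingLog (latticeAngle ε) + (2 * (k : ℂ) + 1) * Real.pi * Complex.I).re =
      leadingLog (latticeAngle ε) := by simp
  rw [e]
  exact hL

/-- For small `ε`, the numbers `branchZero ε k` are the unique solutions of the branch equations. -/
theorem eventually_isBranchZero_iff :
    ∀ᶠ ε in 𝓝[>] (0 : ℝ), 0 < ε ∧ ε < 1 ∧ 0 < latticeAngle ε ∧ latticeAngle ε ≤ 1 / 4 ∧
      ∀ (k : ℤ) (v : ℂ), IsBranchZero (latticeAngle ε) k v ↔ v = branchZero ε k - 1 := by
  filter_upwards [eventually_existsUnique_isBranchZero] with ε h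
  obtain ⟨h1, h2, h3, h4, h5⟩ := h
  refine ⟨h1, h2, h3, h4, fun k v => ?_⟩
  have hs : IsBranchZero (latticeAngle ε) k (branchZero ε k - 1) := by
    rw [branchZero, add_sub_cancel_left]
    exact Classical.epsilon_spec (h5 k).exists
  exact ⟨fun h => (h5 k).unique h hs, fun h => h ▸ hs⟩

/-- An odd multiple of `π` exceeds `1 ≥ |im P|`. Nonreal branch zeros cannot be trivial zeros of
`ζ`. -/
theorem IsBranchZero.im_ne_zero {θ : ℝ} (h0 : 0 < θ) (h1 : θ ≤ 1 / 4) {k : ℤ} {v : ℂ}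
    (h : IsBranchZero θ k v) : v.im ≠ 0 := by
  intro hv
  have hp := abs_le.mp ((Complex.abs_im_le_norm _).trans (norm_perturbation_le h0 h1 h.1))
  have him := congrArg Complex.im h.2
  rw [Complex.im_mul_ofReal, hv] at him
  have e : (0 : ℝ) = (2 * k + 1) * Real.pi + (perturbation θ v).im := by
    simpa using him
  have hpi := Real.pi_gt_three
  rcases le_or_gt 0 k with hk | hk
  · have : (0 : ℝ) ≤ k := by exact_mod_cast hk
    nlinarith
  · have : (k : ℝ) ≤ -1 := by exact_mod_cast (show k ≤ -1 by omega)
    nlinarith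

theorem IsBranchZero.branch_unique {θ : ℝ} {k j : ℤ} {v : ℂ}
    (hk : IsBranchZero θ k v) (hj : IsBranchZero θ j v) : k = j := by
  have h := hk.2.symm.trans hj.2
  have h2 : ((k : ℂ) - j) * (2 * Real.pi * Complex.I) = 0 := by linear_combination h
  rcases mul_eq_zero.mp h2 with h3 | h3
  · exact_mod_cast sub_eq_zero.mp h3
  · exact absurd h3 Complex.two_pi_I_ne_zero

theorem eventually_branchZero :
    ∀ᶠ ε in 𝓝[>] (0 : ℝ), Function.Injective (branchZero ε) ∧
      ∀ k : ℤ, branchZero ε k ∈ energyZeros (1 - ε) ∧ riemannZeta (branchZero ε k) ≠ 0 ∧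
        (branchZero ε k).re < 0 := by
  filter_upwards [eventually_isBranchZero_iff] with ε h
  obtain ⟨h1, h2, h3, h4, h5⟩ := h
  have hb : ∀ k, IsBranchZero (latticeAngle ε) k (branchZero ε k - 1) := fun k =>
    (h5 k _).mpr rfl
  refine ⟨fun k j hkj => (hb k).branch_unique (hkj ▸ hb j), fun k => ?_⟩
  have hre : (branchZero ε k).re < 0 := by
    have := (hb k).1
    simp at this
    linarith
  refine ⟨⟨fun h => by rw [h] at hre; norm_num at hre, ?_⟩, fun hζ => ?_, hre⟩
  · exact (latticeEnergy_eq_zero_iff (by linarith) hre).mpr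
      (Or.inr ((dualSeries_eq_zero_iff h3 h4 (hb k).1).mpr ⟨k, (hb k).2⟩))
  · obtain ⟨n, hn⟩ := riemannZeta_eq_zero_of_re_neg hre hζ
    refine (hb k).im_ne_zero h3 h4 ?_
    rw [hn]
    simp

/-- The strip `-10 ≤ re v ≤ σ - 1` is free of zeros of the dual series; left of it the branch
equations list them all. -/
theorem eventually_mem_energyZeros_iff {σ : ℝ} (hσ : σ < 0) :
    ∀ᶠ ε in 𝓝[>] (0 : ℝ), ∀ s : ℂ, s.re ≤ σ →
      (s ∈ energyZeros (1 - ε) ↔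
        (∃ n : ℕ, s = -2 * ((n : ℂ) + 1)) ∨ ∃ k : ℤ, s = branchZero ε k) := by
  filter_upwards [eventually_isBranchZero_iff, eventually_branchZero,
    tendsto_latticeAngle.eventually ((eventually_dualSeries_ne_zero 10 hσ).filter_mono
      nhdsWithin_le_nhds)] with ε h hz hne s hs
  obtain ⟨h1, h2, h3, h4, h5⟩ := h
  have hs0 : s.re < 0 := by linarith
  have hiff := latticeEnergy_eq_zero_iff (ε := ε) (by linarith) hs0
  constructor
  · rintro ⟨-, hE⟩
    refine (hiff.mp hE).imp_right fun hd => ?_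
    have hre : (s - 1).re ≤ -10 := by
      by_contra hcon
      exact hne (s - 1) (by linarith) (by simp; linarith) hd
    obtain ⟨k, hk⟩ := (dualSeries_eq_zero_iff h3 h4 hre).mp hd
    exact ⟨k, sub_left_injective ((h5 k _).mp ⟨hre, hk⟩)⟩
  · rintro (hn | ⟨k, rfl⟩)
    · exact ⟨fun h => by rw [h] at hs0; norm_num at hs0, hiff.mpr (Or.inl hn)⟩
    · exact (hz.2 k).1

/-! ### Zeros near the zeros of `ζ` -/

theorem exists_pos_le_norm_riemannZeta {K : Set ℂ} (hK : IsCompact K)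
    (h0 : ∀ s ∈ K, riemannZeta s ≠ 0) : ∃ c : ℝ, 0 < c ∧ ∀ s ∈ K, s ≠ 1 → c ≤ ‖riemannZeta s‖ := by
  refine hK.induction_on (p := fun A => ∃ c : ℝ, 0 < c ∧ ∀ s ∈ A, s ≠ 1 → c ≤ ‖riemannZeta s‖)
    ⟨1, one_pos, by simp⟩ (fun A B hAB ⟨c, hc, h⟩ => ⟨c, hc, fun s hs => h s (hAB hs)⟩)
    (fun A B ⟨c, hc, h⟩ ⟨d, hd, h'⟩ => ⟨min c d, lt_min hc hd, ?_⟩) (fun s hs => ?_)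
  · rintro s (hs | hs) h1
    · exact (min_le_left _ _).trans (h s hs h1)
    · exact (min_le_right _ _).trans (h' s hs h1)
  · rcases eq_or_ne s 1 with rfl | hs1
    · have h1 := riemannZeta_residue_one.norm.eventually (lt_mem_nhds (a := 1 / 2) (by norm_num))
      rw [eventually_nhdsWithin_iff] at h1
      have h2 := h1.and (Metric.ball_mem_nhds (1 : ℂ) one_pos)
      refine ⟨_, nhdsWithin_le_nhds h2, 1 / 2, by norm_num, fun t ht ht1 => ?_⟩
      have h3 := ht.1 ht1
      have h4 : ‖t - 1‖ < 1 := by simpa [dist_eq_norm] using ht.2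
      rw [norm_mul] at h3
      nlinarith [norm_nonneg (riemannZeta t)]
    · have hpos := norm_pos_iff.mpr (h0 s hs)
      have h1 := (differentiableAt_riemannZeta hs1).continuousAt.norm.eventually
        (lt_mem_nhds (half_lt_self hpos))
      exact ⟨_, nhdsWithin_le_nhds h1, _, half_pos hpos, fun t ht _ => le_of_lt ht⟩

theorem eventually_near_zeta_zero {T η : ℝ} (hη : 0 < η) :
    ∀ᶠ ε in 𝓝[>] (0 : ℝ), ∀ s ∈ energyZeros (1 - ε), |s.im| ≤ T →
      (∃ z : ℂ, z ≠ 1 ∧ riemannZeta z = 0 ∧ dist s z < η) ∨ ∃ k : ℤ, s = branchZero ε k := by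
  set K : Set ℂ := Set.Icc (-(1 / 2)) 4 ×ℂ Set.Icc (-T) T with hKdef
  have hK : IsCompact K := isCompact_Icc.reProdIm isCompact_Icc
  set V : Set ℂ := ⋃ z ∈ riemannZetaZeros, Metric.ball z η
  have hV : IsOpen V := isOpen_biUnion fun _ _ => Metric.isOpen_ball
  have hK' : IsCompact (K \ V) := hK.diff hV
  obtain ⟨c, hc, hζ⟩ := exists_pos_le_norm_riemannZeta hK' fun s hs h0 =>
    hs.2 (Set.mem_biUnion (show s ∈ riemannZetaZeros from h0) (Metric.mem_ball_self hη))
  obtain ⟨R, hR⟩ := hK.isBounded.exists_norm_le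
  filter_upwards [eventually_mem_energyZeros_iff (show (-(1 / 2) : ℝ) < 0 by norm_num),
    eventually_norm_latticeEnergy_sub_le (R + 1) (half_pos hc),
    eventually_latticeEnergy_ne_zero T] with ε h1 h2 h3 s hs him
  rcases le_or_gt s.re (-(1 / 2)) with hre | hre
  · refine ((h1 s hre).mp hs).imp_left ?_
    rintro ⟨n, rfl⟩
    refine ⟨_, fun h => ?_, riemannZeta_neg_two_mul_nat_add_one n, by simpa using hη⟩
    rw [h] at hre
    norm_num at hre
  · left
    have h4 : s.re < 4 := by
      by_contra hcon
      exact h3 s (not_lt.mp hcon) him hs.2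
    have hsK : s ∈ K := ⟨⟨hre.le, h4.le⟩, abs_le.mp him⟩
    by_contra hcon
    push Not at hcon
    have hsV : s ∉ V := by
      intro hV'
      obtain ⟨z, hz, hsz⟩ := Set.mem_iUnion₂.mp hV'
      refine absurd hsz (not_lt.mpr (hcon z (fun h => ?_) hz))
      -- The zero set used for `V` does not exclude `1` by definition, but the value assigned to
      -- `riemannZeta 1` is nonzero.
      rw [h] at hz
      exact riemannZeta_one_ne_zero hz
    have h5 := hζ s ⟨hsK, hsV⟩ hs.1
    have h6 := h2 s hs.1 (by linarith) (by linarith [hR s hsK])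
    rw [show latticeEnergy s (1 - ε) = 0 from hs.2, zero_sub, norm_neg] at h6
    linarith

/-- Otherwise `1 / f` would violate the maximum modulus principle at the centre. -/
theorem exists_zero_of_norm_lt {f : ℂ → ℂ} {z : ℂ} {r m : ℝ} (hr : 0 < r) (hm : 0 < m)
    (hd : ∀ w ∈ Metric.closedBall z r, DifferentiableAt ℂ f w)
    (hs : ∀ w ∈ Metric.sphere z r, m ≤ ‖f w‖) (hz : ‖f z‖ < m) :
    ∃ w ∈ Metric.closedBall z r, f w = 0 := by
  by_contra! hne
  have hcl : closure (Metric.ball z r) = Metric.closedBall z r := closure_ball z hr.ne'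
  have hdiff : DiffContOnCl ℂ (fun w => (f w)⁻¹) (Metric.ball z r) := by
    refine DifferentiableOn.diffContOnCl fun w hw => ?_
    rw [hcl] at hw
    exact ((hd w hw).inv (hne w hw)).differentiableWithinAt
  have h := Complex.norm_le_of_forall_mem_frontier_norm_le Metric.isBounded_ball hdiff
    (C := m⁻¹) (fun w hw => ?_) (subset_closure (Metric.mem_ball_self hr))
  · rw [norm_inv] at h
    have h0 : 0 < ‖f z‖ := norm_pos_iff.mpr (hne z (Metric.mem_closedBall_self hr.le))
    exact absurd ((inv_le_inv₀ h0 hm).mp h) (not_le.mpr hz)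
  · rw [frontier_ball z hr.ne'] at hw
    rw [norm_inv]
    exact inv_anti₀ hm (hs w hw)

theorem eventually_exists_energyZero {z : ℂ} (hz1 : z ≠ 1) (hz : riemannZeta z = 0) {η : ℝ}
    (hη : 0 < η) : ∀ᶠ ε in 𝓝[>] (0 : ℝ), ∃ s ∈ energyZeros (1 - ε), dist s z < η := by
  rcases lt_or_ge z.re 0 with hre | hre
  · filter_upwards [Ioo_mem_nhdsGT (zero_lt_one' ℝ)] with ε hε
    exact ⟨z, ⟨hz1, (latticeEnergy_eq_zero_iff (by linarith [hε.2]) hre).mpr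
      (Or.inl (riemannZeta_eq_zero_of_re_neg hre hz))⟩, by simpa using hη⟩
  · have hiso : ∀ᶠ w in 𝓝[≠] z, riemannZeta w ≠ 0 := by
      have hfin := (isCompact_closedBall z 1).inter_riemannZetaZeros_finite
      have hcl : IsClosed (Metric.closedBall z 1 ∩ (riemannZetaZeros \ {z})) :=
        (hfin.subset (by intro w hw; exact ⟨hw.1, hw.2.1⟩)).isClosed
      have hmem : (Metric.closedBall z 1 ∩ (riemannZetaZeros \ {z}))ᶜ ∈ 𝓝 z :=
        hcl.isOpen_compl.mem_nhds (by simp)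
      rw [eventually_nhdsWithin_iff]
      filter_upwards [hmem, Metric.closedBall_mem_nhds z one_pos] with w h1 h2 h3 h4
      exact h1 ⟨h2, h4, h3⟩
    rw [eventually_nhdsWithin_iff, Metric.eventually_nhds_iff] at hiso
    obtain ⟨r₀, hr₀, hiso⟩ := hiso
    -- `r < 1/2` keeps the disc in `re s > -3/4`, `r < dist 1 z` avoids the pole, and `r < r₀` makes
    -- `z` the only zero of `ζ` in it.
    obtain ⟨r, hr0, hr⟩ : ∃ r, 0 < r ∧ r < min (min r₀ η) (min (1 / 2) (dist 1 z)) :=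
      exists_between (lt_min (lt_min hr₀ hη) (lt_min (by norm_num) (dist_pos.mpr hz1.symm)))
    simp only [lt_min_iff] at hr
    obtain ⟨⟨hr1, hr2⟩, hr3, hr4⟩ := hr
    have hball : ∀ w ∈ Metric.closedBall z r, w ≠ 1 := by
      rintro w hw rfl
      exact absurd (Metric.mem_closedBall.mp hw) (not_le.mpr hr4)
    obtain ⟨c, hc, hζ⟩ := exists_pos_le_norm_riemannZeta (isCompact_sphere z r) fun w hw =>
      hiso (by rw [Metric.mem_sphere.mp hw]; exact hr1)
        (fun h => by rw [h] at hw; simp at hw; linarith)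
    filter_upwards [eventually_norm_latticeEnergy_sub_le (‖z‖ + 1) (show 0 < c / 3 by positivity)]
      with ε hε
    have hε' : ∀ w ∈ Metric.closedBall z r, ‖latticeEnergy w (1 - ε) - riemannZeta w‖ ≤ c / 3 := by
      intro w hw
      have hwz : ‖w - z‖ ≤ r := by simpa [dist_eq_norm] using hw
      refine hε w (hball w hw) ?_ ?_
      · have := (abs_le.mp ((Complex.abs_re_le_norm (w - z)).trans hwz)).1
        simp at this
        linarith
      · have := norm_add_le (w - z) z
        rw [sub_add_cancel] at this
        linarith
    have hsph : ∀ w ∈ Metric.sphere z r, c / 2 ≤ ‖latticeEnergy w (1 - ε)‖ := by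
      intro w hw
      have hw' := Metric.sphere_subset_closedBall hw
      have h1 := hζ w hw (hball w hw')
      have h2 := hε' w hw'
      have h3 := norm_sub_norm_le (riemannZeta w) (riemannZeta w - latticeEnergy w (1 - ε))
      rw [sub_sub_cancel, norm_sub_rev (riemannZeta w)] at h3
      linarith
    have hcen : ‖latticeEnergy z (1 - ε)‖ < c / 2 := by
      have h2 := hε' z (Metric.mem_closedBall_self hr0.le)
      rw [hz, sub_zero] at h2
      linarith
    obtain ⟨w, hw, hw0⟩ := exists_zero_of_norm_lt (f := fun w => latticeEnergy w (1 - ε)) hr0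
      (half_pos hc) (fun w hw => differentiableAt_latticeEnergy _ (hball w hw)) hsph hcen
    exact ⟨w, ⟨hball w hw, hw0⟩, (Metric.mem_closedBall.mp hw).trans_lt hr2⟩

/-! ### Expansions in `ε`, uniform in the branch number -/

theorem isLittleO_pow_four :
    (fun ε : ℝ => ε ^ 4) =o[𝓝[>] 0] fun ε : ℝ => ε ^ (2 * logRatio) := by
  have ht : Tendsto (fun ε : ℝ => ε ^ (4 - 2 * logRatio)) (𝓝[>] 0) (𝓝 0) := by
    have hpos : 0 < 4 - 2 * logRatio := by linarith [logRatio_lt_two]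
    have := (Real.continuousAt_rpow_const 0 (4 - 2 * logRatio) (Or.inr hpos.le)).tendsto
    rw [Real.zero_rpow hpos.ne'] at this
    exact this.mono_left nhdsWithin_le_nhds
  have h := ((isLittleO_one_iff ℝ).mpr ht).mul_isBigO
    (isBigO_refl (fun ε : ℝ => ε ^ (2 * logRatio)) (𝓝[>] 0))
  refine h.congr' ?_ (by simp)
  filter_upwards [self_mem_nhdsWithin] with ε hε
  rw [← Real.rpow_add hε, sub_add_cancel]
  norm_cast

/-- Since `2 ^ logRatio = 3`, the factor `3` is absorbed into the power; hence the constants `8 / 3`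
and `π² / 8`. -/
theorem three_mul_sq_pi_rpow :
    3 * (Real.pi / 4) ^ (2 * logRatio) = (Real.pi ^ 2 / 8) ^ logRatio := by
  have h3 : (2 : ℝ) ^ logRatio = 3 := by
    rw [Real.rpow_def_of_pos two_pos, logRatio, mul_div_cancel₀ _ (Real.log_pos one_lt_two).ne',
      Real.exp_log three_pos]
  rw [Real.rpow_mul (by positivity), ← h3, ← Real.mul_rpow zero_le_two (by positivity)]
  congr 1
  norm_cast
  ring

theorem isLittleO_latticeAngle_rpow_sub :
    (fun ε : ℝ => 8 * latticeAngle ε ^ (2 * logRatio) -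
      8 / 3 * (Real.pi ^ 2 / 8) ^ logRatio * ε ^ (2 * logRatio)) =o[𝓝[>] 0]
      fun ε : ℝ => ε ^ (2 * logRatio) := by
  have hc : ContinuousAt (fun ε : ℝ => 8 * (Real.pi / 4) ^ (2 * logRatio) *
      (((1 - ε / 2)⁻¹) ^ (2 * logRatio) - 1)) 0 := by
    refine continuousAt_const.mul (ContinuousAt.sub (ContinuousAt.rpow_const
      (ContinuousAt.inv₀ (by fun_prop) (by norm_num)) (Or.inl (by norm_num))) continuousAt_const)
  have ht := hc.tendsto
  norm_num at ht
  have h := ((isLittleO_one_iff ℝ).mpr (ht.mono_left nhdsWithin_le_nhds)).mul_isBigO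
    (isBigO_refl (fun ε : ℝ => ε ^ (2 * logRatio)) (𝓝[>] 0))
  refine h.congr' ?_ (by simp)
  filter_upwards [Ioo_mem_nhdsGT (zero_lt_one' ℝ)] with ε hε
  have h1 : 0 < 1 - ε / 2 := by linarith [hε.2]
  have hε0 := hε.1
  rw [latticeAngle_eq (by linarith [hε.2]), Real.mul_rpow (by positivity) (by positivity),
    Real.mul_rpow (by positivity) (by positivity), ← three_mul_sq_pi_rpow]
  ring

theorem eventually_norm_branchZero_sub_le {c : ℝ} (hc : 0 < c) :
    ∀ᶠ ε in 𝓝[>] (0 : ℝ), ∀ k : ℤ, ‖(branchZero ε k - 1) * Real.log 2 -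
      (nonoscillatingPart ε + (2 * k + 1) * Real.pi * Complex.I +
        (8 / 3 * (Real.pi ^ 2 / 8) ^ logRatio * ε ^ (2 * logRatio) : ℝ) * branchPhase k)‖ ≤
      c * ε ^ (2 * logRatio) := by
  -- The second factor imposes no condition on `k`, so an estimate along `l` is one as `ε → 0⁺`
  -- uniform in `k`.
  set l : Filter (ℝ × ℤ) := 𝓝[>] (0 : ℝ) ×ˢ 𝓟 Set.univ
  have hfst : Tendsto Prod.fst l (𝓝[>] (0 : ℝ)) := tendsto_fst
  have hθ : Tendsto (fun p : ℝ × ℤ => latticeAngle p.1) l (𝓝[>] 0) :=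
    tendsto_latticeAngle.comp hfst
  have hv : ∀ᶠ p in l, IsBranchZero (latticeAngle p.1) p.2 (branchZero p.1 p.2 - 1) :=
    eventually_prod_principal_iff.mpr (eventually_isBranchZero_iff.mono fun ε h k _ =>
      (h.2.2.2.2 k _).mpr rfl)
  have hsmall := isLittleO_pow_four.comp_tendsto hfst
  have h1 := ((isBigO_branchZero_sub hθ hv).trans
    ((isBigO_latticeAngle.comp_tendsto hfst).pow 4)).trans_isLittleO hsmall
  have h2 : (fun p : ℝ × ℤ => ((leadingLog (latticeAngle p.1) + latticeAngle p.1 ^ 2 -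
      nonoscillatingPart p.1 : ℝ) : ℂ)) =o[l] fun p => p.1 ^ (2 * logRatio) := by
    have := (isBigO_leadingLog_latticeAngle.comp_tendsto hfst).trans_isLittleO hsmall
    rw [← isLittleO_norm_left] at this ⊢
    exact this.congr_left fun p => (Complex.norm_real _).symm
  have h3 : (fun p : ℝ × ℤ => ((8 * latticeAngle p.1 ^ (2 * logRatio) -
      8 / 3 * (Real.pi ^ 2 / 8) ^ logRatio * p.1 ^ (2 * logRatio) : ℝ) : ℂ) * branchPhase p.2)
      =o[l] fun p => p.1 ^ (2 * logRatio) := by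
    have := isLittleO_latticeAngle_rpow_sub.comp_tendsto hfst
    rw [← isLittleO_norm_left] at this ⊢
    refine this.congr_left fun p => ?_
    rw [norm_mul, norm_branchPhase, mul_one, Complex.norm_real]
    rfl
  have h4 := ((h1.add h2).add h3).def hc
  filter_upwards [eventually_prod_principal_iff.mp h4, self_mem_nhdsWithin] with ε h hε k
  have h5 := h k (Set.mem_univ _)
  simp only [Function.comp] at h5
  rw [Real.norm_of_nonneg (Real.rpow_nonneg (le_of_lt hε) _)] at h5
  refine (le_of_eq (congrArg _ ?_)).trans h5
  push_cast
  ring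

/-- The `-3` is `1 - 4`: the shift `s = v + 1` together with `-2 log 4 / log 2`. -/
theorem nonoscillatingPart_div (ε : ℝ) : 1 + nonoscillatingPart ε / Real.log 2 =
    2 / Real.log 2 * Real.log ε + (-3 + 2 / Real.log 2 * Real.log Real.pi)
      + 1 / Real.log 2 * ε + 1 / Real.log 2 * (1 / 4 + 7 * Real.pi ^ 2 / 24) * ε ^ 2
      + 1 / Real.log 2 * (1 / 12 + 7 * Real.pi ^ 2 / 24) * ε ^ 3 := by
  have hl := (Real.log_pos one_lt_two).ne'
  have h4 : Real.log 4 = 2 * Real.log 2 := by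
    rw [show (4 : ℝ) = 2 ^ 2 by norm_num, Real.log_pow]; norm_num
  rw [nonoscillatingPart, Real.log_div Real.pi_ne_zero (by norm_num), h4]
  field_simp
  ring

theorem eventually_abs_re_branchZero_sub_le {c : ℝ} (hc : 0 < c) :
    ∀ᶠ ε in 𝓝[>] (0 : ℝ), ∀ k : ℤ, |(branchZero ε k).re -
      (1 + nonoscillatingPart ε / Real.log 2 + 8 / (3 * Real.log 2) *
        (Real.pi ^ 2 / 8) ^ logRatio * Real.cos (logRatio * ((2 * (k : ℝ) + 1) * Real.pi)) *
          ε ^ (2 * logRatio))| ≤ c * ε ^ (2 * logRatio) := by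
  have hl := Real.log_pos one_lt_two
  filter_upwards [eventually_norm_branchZero_sub_le (mul_pos hc hl)] with ε h k
  have h1 := (Complex.abs_re_le_norm _).trans (h k)
  rw [Complex.sub_re, Complex.re_mul_ofReal, Complex.add_re, Complex.add_re,
    Complex.re_ofReal_mul, branchPhase, Complex.exp_ofReal_mul_I_re] at h1
  have e : (((2 * k + 1) * Real.pi * Complex.I : ℂ)).re = 0 := by simp
  rw [e, Complex.ofReal_re, Complex.sub_re, Complex.one_re] at h1
  rw [← mul_le_mul_iff_left₀ hl]
  refine le_trans (le_of_eq ?_) (h1.trans (le_of_eq (by ring)))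
  have habs : ∀ x : ℝ, |x| * Real.log 2 = |x * Real.log 2| := fun x => by
    rw [abs_mul, abs_of_pos hl]
  rw [habs]
  congr 1
  field_simp
  ring

theorem eventually_abs_im_branchZero_sub_le {c : ℝ} (hc : 0 < c) :
    ∀ᶠ ε in 𝓝[>] (0 : ℝ), ∀ k : ℤ, |(branchZero ε k).im -
      (1 / Real.log 2 * ((2 * (k : ℝ) + 1) * Real.pi) + 8 / (3 * Real.log 2) *
        (Real.pi ^ 2 / 8) ^ logRatio * Real.sin (logRatio * ((2 * (k : ℝ) + 1) * Real.pi)) *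
          ε ^ (2 * logRatio))| ≤ c * ε ^ (2 * logRatio) := by
  have hl := Real.log_pos one_lt_two
  filter_upwards [eventually_norm_branchZero_sub_le (mul_pos hc hl)] with ε h k
  have h1 := (Complex.abs_im_le_norm _).trans (h k)
  rw [Complex.sub_im, Complex.im_mul_ofReal, Complex.add_im, Complex.add_im,
    Complex.im_ofReal_mul, branchPhase, Complex.exp_ofReal_mul_I_im] at h1
  have e : (((2 * k + 1) * Real.pi * Complex.I : ℂ)).im = (2 * k + 1) * Real.pi := by simp
  rw [e, Complex.ofReal_im, Complex.sub_im, Complex.one_im] at h1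
  rw [← mul_le_mul_iff_left₀ hl]
  refine le_trans (le_of_eq ?_) (h1.trans (le_of_eq (by ring)))
  have habs : ∀ x : ℝ, |x| * Real.log 2 = |x * Real.log 2| := fun x => by
    rw [abs_mul, abs_of_pos hl]
  rw [habs]
  congr 1
  field_simp
  ring

theorem tendsto_re_branchZero (k : ℤ) :
    Tendsto (fun ε : ℝ => (branchZero ε k).re) (𝓝[>] 0) atBot := by
  have hl := Real.log_pos one_lt_two
  have h : Tendsto (fun ε => 1 + (leadingLog (latticeAngle ε) + 1) / Real.log 2) (𝓝[>] 0) atBot :=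
    tendsto_atBot_add_const_left _ _ ((tendsto_atBot_add_const_right _ _
      (tendsto_leadingLog.comp tendsto_latticeAngle)).atBot_div_const hl)
  refine tendsto_atBot_mono' _ ?_ h
  filter_upwards [eventually_isBranchZero_iff] with ε h
  obtain ⟨-, -, h3, h4, h5⟩ := h
  have hb := (h5 k _).mpr rfl
  have hp := (abs_le.mp ((Complex.abs_re_le_norm _).trans (norm_perturbation_le h3 h4 hb.1))).2
  have hre := congrArg Complex.re hb.2
  rw [Complex.re_mul_ofReal] at hre
  have e : ((branchZero ε k).re - 1) * Real.log 2 = leadingLog (latticeAngle ε) +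
      (perturbation (latticeAngle ε) (branchZero ε k - 1)).re := by simpa using hre
  have : (branchZero ε k).re - 1 ≤ (leadingLog (latticeAngle ε) + 1) / Real.log 2 := by
    rw [le_div_iff₀ hl]
    linarith
  linarith

theorem tendstoUniformly_im_branchZero :
    TendstoUniformly (fun (ε : ℝ) (k : ℤ) => (branchZero ε k).im)
      (fun k : ℤ => (2 * (k : ℝ) + 1) * Real.pi / Real.log 2) (𝓝[>] (0 : ℝ)) := by
  have hl := Real.log_pos one_lt_two
  rw [Metric.tendstoUniformly_iff]
  intro e he
  set C : ℝ := 8 / (3 * Real.log 2) * (Real.pi ^ 2 / 8) ^ logRatio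
  have hC : 0 ≤ C := by positivity
  have ht : Tendsto (fun ε : ℝ => (C + 1) * ε ^ (2 * logRatio)) (𝓝[>] 0) (𝓝 0) := by
    have hpos : 0 < 2 * logRatio := by linarith [one_lt_logRatio]
    have := (Real.continuousAt_rpow_const 0 (2 * logRatio) (Or.inr hpos.le)).tendsto
    rw [Real.zero_rpow hpos.ne'] at this
    simpa using (this.mono_left nhdsWithin_le_nhds).const_mul (C + 1)
  filter_upwards [eventually_abs_im_branchZero_sub_le one_pos, ht.eventually (gt_mem_nhds he),
    self_mem_nhdsWithin] with ε h1 h2 h3 k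
  have hε : 0 ≤ ε ^ (2 * logRatio) := Real.rpow_nonneg (le_of_lt h3) _
  have h4 := h1 k
  set S := Real.sin (logRatio * ((2 * (k : ℝ) + 1) * Real.pi))
  have hS : |C * S * ε ^ (2 * logRatio)| ≤ C * ε ^ (2 * logRatio) := by
    rw [abs_mul, abs_mul, abs_of_nonneg hC, abs_of_nonneg hε]
    have := Real.abs_sin_le_one (logRatio * ((2 * (k : ℝ) + 1) * Real.pi))
    have : C * |S| ≤ C * 1 := by gcongr
    nlinarith
  rw [dist_comm, Real.dist_eq]
  have e1 : (branchZero ε k).im - (2 * (k : ℝ) + 1) * Real.pi / Real.log 2 =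
      ((branchZero ε k).im - (1 / Real.log 2 * ((2 * (k : ℝ) + 1) * Real.pi) +
        C * S * ε ^ (2 * logRatio))) + C * S * ε ^ (2 * logRatio) := by ring
  rw [e1]
  refine (abs_add_le _ _).trans_lt ?_
  linarith

theorem theorem1 :
    ∃ ρ : ℝ → ℤ → ℂ,
      -- for all small `ε`, the `ρ ε k` are distinct zeros of `E(·, 1 - ε)`, none a zero of `ζ`
      (∀ᶠ ε in 𝓝[>] (0 : ℝ), Function.Injective (ρ ε) ∧
        ∀ k : ℤ, ρ ε k ∈ energyZeros (1 - ε) ∧ riemannZeta (ρ ε k) ≠ 0 ∧ (ρ ε k).re < 0) ∧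
      -- in every half-plane `re s ≤ σ < 0` there are, for small `ε`, no zeros but these
      -- and the trivial ones
      (∀ σ : ℝ, σ < 0 → ∀ᶠ ε in 𝓝[>] (0 : ℝ), ∀ s : ℂ, s.re ≤ σ →
        (s ∈ energyZeros (1 - ε) ↔
          (∃ n : ℕ, s = -2 * ((n : ℂ) + 1)) ∨ ∃ k : ℤ, s = ρ ε k)) ∧
      -- in every strip `|im s| ≤ T`, all other zeros are close to zeros of `ζ`
      (∀ T η : ℝ, 0 < T → 0 < η → ∀ᶠ ε in 𝓝[>] (0 : ℝ), ∀ s ∈ energyZeros (1 - ε), |s.im| ≤ T →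
        (∃ z : ℂ, z ≠ 1 ∧ riemannZeta z = 0 ∧ dist s z < η) ∨ ∃ k : ℤ, s = ρ ε k) ∧
      -- every zero of `ζ` is a limit of zeros
      (∀ z : ℂ, z ≠ 1 → riemannZeta z = 0 → ∀ η : ℝ, 0 < η →
        ∀ᶠ ε in 𝓝[>] (0 : ℝ), ∃ s ∈ energyZeros (1 - ε), dist s z < η) ∧
      -- expansion of the real parts
      (∀ c : ℝ, 0 < c → ∀ᶠ ε in 𝓝[>] (0 : ℝ), ∀ k : ℤ,
        |(ρ ε k).re -
          (2 / Real.log 2 * Real.log ε + (-3 + 2 / Real.log 2 * Real.log Real.pi)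
            + 1 / Real.log 2 * ε
            + 1 / Real.log 2 * (1 / 4 + 7 * Real.pi ^ 2 / 24) * ε ^ 2
            + 1 / Real.log 2 * (1 / 12 + 7 * Real.pi ^ 2 / 24) * ε ^ 3
            + 8 / (3 * Real.log 2) * (Real.pi ^ 2 / 8) ^ (Real.log 3 / Real.log 2)
              * Real.cos (Real.log 3 / Real.log 2 * ((2 * (k : ℝ) + 1) * Real.pi))
              * ε ^ (2 * (Real.log 3 / Real.log 2)))|
          ≤ c * ε ^ (2 * (Real.log 3 / Real.log 2))) ∧
      -- expansion of the imaginary parts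
      (∀ c : ℝ, 0 < c → ∀ᶠ ε in 𝓝[>] (0 : ℝ), ∀ k : ℤ,
        |(ρ ε k).im -
          (1 / Real.log 2 * ((2 * (k : ℝ) + 1) * Real.pi)
            + 8 / (3 * Real.log 2) * (Real.pi ^ 2 / 8) ^ (Real.log 3 / Real.log 2)
              * Real.sin (Real.log 3 / Real.log 2 * ((2 * (k : ℝ) + 1) * Real.pi))
              * ε ^ (2 * (Real.log 3 / Real.log 2)))|
          ≤ c * ε ^ (2 * (Real.log 3 / Real.log 2))) ∧
      -- the off-critical zeros vanish at `-∞`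
      (∀ k : ℤ, Tendsto (fun ε : ℝ => (ρ ε k).re) (𝓝[>] 0) atBot) ∧
      -- their imaginary parts crystallize on `(2ℤ + 1) π / ln 2`, uniformly in `k`
      TendstoUniformly (fun (ε : ℝ) (k : ℤ) => (ρ ε k).im)
        (fun k : ℤ => (2 * (k : ℝ) + 1) * Real.pi / Real.log 2) (𝓝[>] (0 : ℝ)) := by
  refine ⟨branchZero, eventually_branchZero, fun σ hσ => eventually_mem_energyZeros_iff hσ,
    fun T η _ hη => eventually_near_zeta_zero hη,
    fun z hz1 hz η hη => eventually_exists_energyZero hz1 hz hη, fun c hc => ?_,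
    fun c hc => eventually_abs_im_branchZero_sub_le hc, tendsto_re_branchZero,
    tendstoUniformly_im_branchZero⟩
  simp_rw [← nonoscillatingPart_div]
  exact eventually_abs_re_branchZero_sub_le hc
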